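/- Let $G$ be a finite simple graph on $n$ vertices and let $\pi$ be a uniformly random permutation (ranking) of its edges. Let $H$ be a subgraph of $G$. \emph{Edge query process.} To query an edge $e$ of $H$, query recursively the edges of $H$ that are incident to $e$ and have lower rank than $e$, one after the other in increasing order of rank. As soon as one of them is found to be matched, stop: $e$ is not matched. If none of them is matched, $e$ is matched. \emph{Vertex query process.} From a vertex $v$, run the edge query process on the edges of $H$ at $v$ in increasing order of rank, and stop as soon as a matched edge is found. \emph{Truncation.} In the $n^{\epsilon}$-truncated vertex query process, once the total number of edge queries made for $v$ (recursive ones included) exceeds $n^{\epsilon}$, the process is stopped and $v$ is left unsettled. \emph{One application.} On the current graph $H$, run the $n^{\epsilon}$-truncated vertex query process from every vertex. Call a vertex known to be matched if it is an endpoint of a matched edge with which one of these truncated processes ended. Remove all vertices known to be matched, together with their incident edges. The same $\pi$ and the same threshold $n^\epsilon$, where $n$ is the number of vertices of the initial graph $G$, are used in all applications, and the first application is to $H=G$. \textbf{Lemma.} For every $c>0$ there is a constant $C>0$, depending only on $c$, such that for every constant $\epsilon\in(0,1)$ there is $n_0$ such that for every $n\ge n_0$ and every graph $G$ on $n$ vertices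 the following holds: with probability at least $1-n^{-c}$ over $\pi$, no edge is left after $\lfloor C/\epsilon\rfloor$ applications of the process. In other words, with high probability $O(1/\epsilon)$ applications make the graph empty. -/

import Mathlib

namespace MatchingQuery

/-- An ordering (permutation) of the edges of `G`: `π i` is the edge of rank `i`. -/
abbrev EdgeOrder {V : Type*} (G : SimpleGraph V) : Type _ :=
  Fin G.edgeSet.ncard ≃ G.edgeSet

/-- Ask the oracle `q` about the members of a list one after the other and stop at the first
positive answer.  The oracle returns an answer together with its cost.  The result is the first
member with a positive answer (if there is one) and the total cost of the calls made. -/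
def scan {α : Type*} (q : α → Bool × ℕ) : List α → Option α × ℕ
  | [] => (none, 0)
  | a :: l =>
    if (q a).1 = true then (some a, (q a).2)
    else ((scan q l).1, (q a).2 + (scan q l).2)

section

variable {V : Type*} {G : SimpleGraph V}

open Classical in
/-- The ranks of the edges of the current graph `H` that are incident to the edge of rank `i`
and of lower rank, in increasing order. -/
noncomputable def earlierEdges (π : EdgeOrder G) (H : SimpleGraph V)
    (i : Fin G.edgeSet.ncard) : List (Fin G.edgeSet.ncard) :=
  (Finset.univ.filter fun j => j < i ∧ (π j : Sym2 V) ∈ H.edgeSet ∧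
    ∃ v : V, v ∈ (π i : Sym2 V) ∧ v ∈ (π j : Sym2 V)).sort (· ≤ ·)

open Classical in
/-- The ranks of the edges of the current graph `H` at the vertex `v`, in increasing order. -/
noncomputable def edgesAt (π : EdgeOrder G) (H : SimpleGraph V) (v : V) :
    List (Fin G.edgeSet.ncard) :=
  (Finset.univ.filter fun j => (π j : Sym2 V) ∈ H.edgeSet ∧ v ∈ (π j : Sym2 V)).sort (· ≤ ·)

/-- The edge query process: query recursively the incident edges of lower rank, in increasing
order of rank, until one of them is found to be matched.  The edge is matched if and only if no
such edge is found.  The second component is the number of edge queries made in total, the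
present one included. -/
noncomputable def edgeQuery (π : EdgeOrder G) (H : SimpleGraph V)
    (i : Fin G.edgeSet.ncard) : Bool × ℕ :=
  let s := scan (fun j : {j // j ∈ earlierEdges π H i} => edgeQuery π H j.1)
    (earlierEdges π H i).attach
  (s.1.isNone, s.2 + 1)
termination_by i
decreasing_by
  have h := j.2
  simp only [earlierEdges, Finset.mem_sort, Finset.mem_filter] at h
  exact h.2.1

/-- The vertex query process: run the edge query process on the edges at `v`, in increasing order
of rank, until a matched one is found.  Returns that edge (if any) and the total number of edge
queries, recursive ones included. -/
noncomputable def vertexQuery (π : EdgeOrder G) (H : SimpleGraph V) (v : V) :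
    Option (Fin G.edgeSet.ncard) × ℕ :=
  scan (edgeQuery π H) (edgesAt π H v)

open Classical in
/-- The vertex query process that is stopped as soon as the total number of edge queries
exceeds `B`.  The value `none` means that the process was stopped (`v` is unsettled). -/
noncomputable def truncatedVertexQuery (π : EdgeOrder G) (B : ℝ) (H : SimpleGraph V) (v : V) :
    Option (Option (Fin G.edgeSet.ncard)) :=
  if ((vertexQuery π H v).2 : ℝ) ≤ B then some (vertexQuery π H v).1 else none

/-- The vertex `w` is known to be matched: the truncated process of some vertex ended with a
matched edge, and `w` is an endpoint of it. -/
def KnownMatched (π : EdgeOrder G) (B : ℝ) (H : SimpleGraph V) (w : V) : Prop :=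
  ∃ (v : V) (i : Fin G.edgeSet.ncard),
    truncatedVertexQuery π B H v = some (some i) ∧ w ∈ (π i : Sym2 V)

/-- One application of the process: run the truncated process from all the vertices, then delete
all vertices known to be matched with their incident edges.  (The deleted vertices are kept as
isolated vertices.) -/
def step (π : EdgeOrder G) (B : ℝ) (H : SimpleGraph V) : SimpleGraph V where
  Adj a b := H.Adj a b ∧ ¬ KnownMatched π B H a ∧ ¬ KnownMatched π B H b
  symm := ⟨fun _ _ h => ⟨h.1.symm, h.2.2, h.2.1⟩⟩
  loopless := ⟨fun _ h => H.irrefl h.1⟩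

end

/-- The probability of an event for a uniformly random ordering of the edges of `G`. -/
noncomputable def orderProb {V : Type*} (G : SimpleGraph V) (P : EdgeOrder G → Prop) : ℝ :=
  (Nat.card {π : EdgeOrder G // P π} : ℝ) / (Nat.card (EdgeOrder G) : ℝ)

end MatchingQuery

set_option linter.unusedSectionVars false

namespace MatchingQuery

/-! The recursive queries made for an edge form its query tree, and the proof controls the size and
the depth of these trees.

Deterministic half. Whenever an application finds a matched edge, it deletes both endpoints. So
surviving edges keep their matching status and their query trees only lose branches
(`isMatched_step_iff`, `children_step_subset`). An edge whose tree has at most `B / 2` nodes, with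
`B = n ^ ε`, disappears (`notMem_step_of_edgeQuery_le`), so every node of a surviving tree was the
root of an old subtree with more than `B / 2` nodes. Old subtrees rooted at the same level are
disjoint parts of the old tree, hence each level keeps at most a fraction `2 / B` of the old size,
and a round shrinks sizes by the factor depth divided by `B / 2` (`edgeQuery_step_le`). With
polynomial sizes and depth `O(log ^ 3 n)`, `O(1 / ε)` rounds push the size below `1`, so no edge is
left.

Probabilistic half. Size and depth are bounded together by giving a node at level `k` the weight
`lam ^ k`, with `lam - 1` at least of order `1 / log ^ 2 n`: a total of at most `n ^ (c + 9)` bounds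
both. Random greedy on the line graph produces these totals, because an edge queries an earlier
neighbour directly exactly when it is still alive as that neighbour is processed. For `lam = 1` the
potential is a supermartingale. For `lam > 1` its relative drift is at most `(lam - 1) * d` over the
number of unprocessed vertices, `d` being the largest alive degree (`sum_potential_next_le`). With
high probability `d ≤ K * m / (s + 1)` after `s ≥ 1` steps (`card_not_balanced_le`), so the drifts
add up to `O((lam - 1) * K * log m) = O(1)`, and Markov's inequality finishes
(`card_orders_exists_weight_gt_le`). -/

/-- The state of the random greedy process: the vertices not yet processed, the vertices that
may still be selected, and a weight that is passed on to the neighbours. -/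
structure GreedyState (α : Type*) where
  rest : Finset α
  alive : Finset α
  weight : α → ℝ

/-! ### One step of random greedy: drift of the potential and of heavy vertices. -/

section Greedy

open Classical

variable {α : Type*} [Fintype α] (L : SimpleGraph α) (lam : ℝ) {m : ℕ}

/-- The members of `A` adjacent to `e`. -/
noncomputable def nbrsIn (A : Finset α) (e : α) : Finset α := A.filter fun f => L.Adj e f

/-- Process the vertex `y`: its alive neighbours receive `lam` times its weight, and if it is
alive it is selected, so that it and its neighbours are no longer alive. -/
noncomputable def GreedyState.next (s : GreedyState α) (y : α) : GreedyState α where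
  rest := s.rest.erase y
  alive := if y ∈ s.alive then s.alive.filter fun f => f ≠ y ∧ ¬ L.Adj y f else s.alive
  weight f := s.weight f + if f ∈ s.alive ∧ L.Adj y f then lam * s.weight y else 0

/-- The state of the greedy process after `t` steps. -/
noncomputable def greedyRun (π : Fin m ≃ α) : ℕ → GreedyState α
  | 0 => ⟨Finset.univ, Finset.univ, fun _ => 1⟩
  | t + 1 => if h : t < m then (greedyRun π t).next L lam (π ⟨t, h⟩) else greedyRun π t

/-- The quantity which is almost a supermartingale along the greedy process. -/
noncomputable def GreedyState.potential (s : GreedyState α) : ℝ :=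
  ∑ e, s.weight e + lam * ∑ e ∈ s.rest, s.weight e * ((nbrsIn L s.alive e).card : ℝ)

variable {L lam}

theorem next_alive_subset (s : GreedyState α) (y : α) : (s.next L lam y).alive ⊆ s.alive := by
  simp only [GreedyState.next]
  split_ifs
  · exact Finset.filter_subset _ _
  · exact Finset.Subset.refl _

theorem mem_next_alive {s : GreedyState α} {y f : α} :
    f ∈ (s.next L lam y).alive ↔ f ∈ s.alive ∧ (y ∈ s.alive → f ≠ y ∧ ¬ L.Adj y f) := by
  simp only [GreedyState.next]
  split_ifs with h <;> simp [h]

theorem next_alive_subset_rest {s : GreedyState α} (h : s.alive ⊆ s.rest) (y : α) :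
    (s.next L lam y).alive ⊆ (s.next L lam y).rest := by
  intro f hf
  have h1 := h (next_alive_subset s y hf)
  simp only [GreedyState.next] at hf ⊢
  refine Finset.mem_erase.2 ⟨?_, h1⟩
  rintro rfl
  split_ifs at hf with h2
  · simp at hf
  · exact h2 hf

theorem nbrsIn_mono {A A' : Finset α} (h : A ⊆ A') (e : α) : nbrsIn L A e ⊆ nbrsIn L A' e :=
  Finset.filter_subset_filter _ h

/-- An alive vertex with `k` alive neighbours is killed by at least `k + 1` choices of the next
vertex. -/
theorem card_alive_next_le {s : GreedyState α} (h : s.alive ⊆ s.rest) {f : α}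
    (hf : f ∈ s.alive) :
    ∑ y ∈ s.rest, (if f ∈ (s.next L lam y).alive then (1 : ℝ) else 0) ≤
      s.rest.card - 1 - (nbrsIn L s.alive f).card := by
  rw [← Finset.sum_filter, Finset.sum_const, nsmul_eq_mul, mul_one]
  have hsub : s.rest.filter (fun y => f ∈ (s.next L lam y).alive) ⊆
      s.rest \ insert f (nbrsIn L s.alive f) := by
    intro y hy
    rw [Finset.mem_filter] at hy
    refine Finset.mem_sdiff.2 ⟨hy.1, fun hy' => ?_⟩
    have h2 := hy.2
    simp only [GreedyState.next] at h2
    rcases Finset.mem_insert.1 hy' with rfl | hy'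
    · simp [hf] at h2
    · simp only [nbrsIn, Finset.mem_filter] at hy'
      simp [hy'.1, hy'.2.symm] at h2
  have hins : insert f (nbrsIn L s.alive f) ⊆ s.rest := by
    intro y hy
    rcases Finset.mem_insert.1 hy with rfl | hy
    · exact h hf
    · exact h (Finset.filter_subset _ _ hy)
  have hc := Finset.card_le_card hsub
  rw [Finset.card_sdiff_of_subset hins, Finset.card_insert_of_notMem (by simp [nbrsIn])] at hc
  have hc2 := Finset.card_le_card hins
  rw [Finset.card_insert_of_notMem (by simp [nbrsIn])] at hc2
  have : ((s.rest.filter (fun y => f ∈ (s.next L lam y).alive)).card : ℝ) ≤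
      ((s.rest.card - ((nbrsIn L s.alive f).card + 1) : ℕ) : ℝ) := by exact_mod_cast hc
  rw [Nat.cast_sub hc2] at this
  push_cast at this
  linarith

theorem card_nbrsIn_eq_sum {A B : Finset α} (h : A ⊆ B) (e : α) :
    ((nbrsIn L A e).card : ℝ) = ∑ f ∈ nbrsIn L B e, if f ∈ A then (1 : ℝ) else 0 := by
  rw [← Finset.sum_filter, Finset.sum_const, nsmul_eq_mul, mul_one]
  congr 2
  ext f
  simp only [nbrsIn, Finset.mem_filter]
  constructor
  · rintro ⟨h1, h2⟩; exact ⟨⟨h h1, h2⟩, h1⟩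
  · rintro ⟨⟨_, h2⟩, h1⟩; exact ⟨h1, h2⟩

/-- The second term of the potential is the weight still waiting to be passed on. Processing `y`
turns its waiting weight into actual weight and creates new waiting weight at its alive neighbours.
In exchange, each alive neighbour `f` of `e` is killed by `k f + 1` choices of `y`: the `1` pays for
the passed weight, the `k f` for the new waiting weight. Only a surplus with factor `lam - 1` is
left over. -/
theorem sum_potential_next_le {s : GreedyState α} (h : s.alive ⊆ s.rest)
    (hw : ∀ e, 0 ≤ s.weight e) (hlam : 1 ≤ lam) {d : ℝ}
    (hd : ∀ f ∈ s.alive, ((nbrsIn L s.alive f).card : ℝ) ≤ d) (hd0 : 0 ≤ d) :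
    ∑ y ∈ s.rest, (s.next L lam y).potential L lam ≤
      (s.rest.card + (lam - 1) * d) * s.potential L lam := by
  have hlam0 : 0 ≤ lam := by linarith
  set k : α → ℝ := fun e => ((nbrsIn L s.alive e).card : ℝ) with hk
  have hk0 : ∀ e, 0 ≤ k e := fun e => Nat.cast_nonneg _
  have hN : (∑ y ∈ s.rest, (1 : ℝ)) = s.rest.card := by simp
  -- the weights after processing `y`
  have h1 : ∀ y, ∑ e, (s.next L lam y).weight e = ∑ e, s.weight e + lam * (s.weight y * k y) := by
    intro y
    simp only [GreedyState.next, Finset.sum_add_distrib]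
    congr 1
    rw [← Finset.sum_filter, Finset.sum_const, nsmul_eq_mul]
    have : (Finset.univ.filter fun f => f ∈ s.alive ∧ L.Adj y f) = nbrsIn L s.alive y := by
      ext f; simp [nbrsIn]
    rw [this, hk]
    ring
  have h2 : ∀ y, ∑ e ∈ (s.next L lam y).rest,
      (s.next L lam y).weight e * ((nbrsIn L (s.next L lam y).alive e).card : ℝ) ≤
      ∑ e ∈ s.rest, s.weight e * ((nbrsIn L (s.next L lam y).alive e).card : ℝ) +
        lam * (s.weight y * ∑ f ∈ nbrsIn L s.alive y, k f) := by
    intro y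
    have hle : ∀ e, ((nbrsIn L (s.next L lam y).alive e).card : ℝ) ≤ k e := fun e => by
      have := Finset.card_le_card (nbrsIn_mono (L := L) (next_alive_subset (L := L) (lam := lam) s y) e)
      simp only [hk]; exact_mod_cast this
    have hw' : ∀ e, 0 ≤ (s.next L lam y).weight e := fun e => by
      simp only [GreedyState.next]
      have := mul_nonneg hlam0 (hw y)
      split_ifs <;> linarith [hw e]
    calc _ ≤ ∑ e ∈ s.rest,
          (s.next L lam y).weight e * ((nbrsIn L (s.next L lam y).alive e).card : ℝ) := by
          -- The saving from erasing `y` is not needed, so its term is kept.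
          refine Finset.sum_le_sum_of_subset_of_nonneg (Finset.erase_subset _ _) ?_
          intro e _ _
          exact mul_nonneg (hw' e) (Nat.cast_nonneg _)
      _ ≤ ∑ e ∈ s.rest, (s.weight e * ((nbrsIn L (s.next L lam y).alive e).card : ℝ) +
          if e ∈ s.alive ∧ L.Adj y e then lam * s.weight y * k e else 0) := by
          refine Finset.sum_le_sum fun e _ => ?_
          have hww : (s.next L lam y).weight e =
            s.weight e + if e ∈ s.alive ∧ L.Adj y e then lam * s.weight y else 0 := rfl
          rw [hww, add_mul]
          gcongr
          split_ifs
          · exact mul_le_mul_of_nonneg_left (hle e) (mul_nonneg hlam0 (hw y))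
          · simp
      _ = _ := by
          rw [Finset.sum_add_distrib]
          congr 1
          rw [← Finset.sum_filter]
          have : (s.rest.filter fun f => f ∈ s.alive ∧ L.Adj y f) = nbrsIn L s.alive y := by
            ext f
            simp only [nbrsIn, Finset.mem_filter]
            exact ⟨fun hf => hf.2, fun hf => ⟨h hf.1, hf⟩⟩
          rw [this, ← Finset.mul_sum]
          ring
  have h3 : ∀ e, ∑ y ∈ s.rest, ((nbrsIn L (s.next L lam y).alive e).card : ℝ) ≤
      (s.rest.card - 1) * k e - ∑ f ∈ nbrsIn L s.alive e, k f := by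
    intro e
    rw [Finset.sum_congr rfl fun y _ =>
      card_nbrsIn_eq_sum (next_alive_subset (L := L) (lam := lam) s y) e, Finset.sum_comm]
    calc _ ≤ ∑ f ∈ nbrsIn L s.alive e, ((s.rest.card : ℝ) - 1 - k f) :=
          Finset.sum_le_sum fun f hf => card_alive_next_le h (Finset.filter_subset _ _ hf)
      _ = _ := by
          rw [Finset.sum_sub_distrib, Finset.sum_const, nsmul_eq_mul]
          ring
  have h4 : ∀ y, ∑ f ∈ nbrsIn L s.alive y, k f ≤ k y * d := by
    intro y
    calc _ ≤ ∑ f ∈ nbrsIn L s.alive y, d :=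
          Finset.sum_le_sum fun f hf => hd f (Finset.filter_subset _ _ hf)
      _ = _ := by rw [Finset.sum_const, nsmul_eq_mul]
  have h5 : ∑ y ∈ s.rest, ∑ e ∈ s.rest,
      s.weight e * ((nbrsIn L (s.next L lam y).alive e).card : ℝ) ≤
      ∑ e ∈ s.rest, s.weight e * ((s.rest.card - 1) * k e - ∑ f ∈ nbrsIn L s.alive e, k f) := by
    rw [Finset.sum_comm]
    refine Finset.sum_le_sum fun e _ => ?_
    rw [← Finset.mul_sum]
    exact mul_le_mul_of_nonneg_left (h3 e) (hw e)
  have hX : 0 ≤ ∑ e, s.weight e := Finset.sum_nonneg fun e _ => hw e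
  calc ∑ y ∈ s.rest, (s.next L lam y).potential L lam
      ≤ ∑ y ∈ s.rest, ((∑ e, s.weight e + lam * (s.weight y * k y)) +
        lam * (∑ e ∈ s.rest, s.weight e * ((nbrsIn L (s.next L lam y).alive e).card : ℝ) +
          lam * (s.weight y * ∑ f ∈ nbrsIn L s.alive y, k f))) := by
        refine Finset.sum_le_sum fun y _ => ?_
        rw [GreedyState.potential, h1]
        gcongr
        exact h2 y
    _ = s.rest.card * ∑ e, s.weight e + lam * ∑ y ∈ s.rest, s.weight y * k y +
        lam * ∑ y ∈ s.rest, ∑ e ∈ s.rest,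
          s.weight e * ((nbrsIn L (s.next L lam y).alive e).card : ℝ) +
        lam * (lam * ∑ y ∈ s.rest, s.weight y * ∑ f ∈ nbrsIn L s.alive y, k f) := by
        simp only [Finset.sum_add_distrib, Finset.mul_sum, Finset.sum_const, nsmul_eq_mul, mul_add]
        ring
    _ ≤ s.rest.card * ∑ e, s.weight e + lam * ∑ y ∈ s.rest, s.weight y * k y +
        lam * (∑ e ∈ s.rest, s.weight e *
          ((s.rest.card - 1) * k e - ∑ f ∈ nbrsIn L s.alive e, k f)) +
        lam * (lam * ∑ y ∈ s.rest, s.weight y * ∑ f ∈ nbrsIn L s.alive y, k f) := by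
        gcongr
    _ = s.rest.card * s.potential L lam +
        lam * ((lam - 1) * ∑ y ∈ s.rest, s.weight y * ∑ f ∈ nbrsIn L s.alive y, k f) := by
        have : ∑ e ∈ s.rest, s.weight e *
            ((s.rest.card - 1) * k e - ∑ f ∈ nbrsIn L s.alive e, k f) =
            (s.rest.card - 1) * ∑ y ∈ s.rest, s.weight y * k y -
            ∑ y ∈ s.rest, s.weight y * ∑ f ∈ nbrsIn L s.alive y, k f := by
          rw [Finset.mul_sum, ← Finset.sum_sub_distrib]
          exact Finset.sum_congr rfl fun e _ => by ring
        rw [this, GreedyState.potential]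
        ring
    _ ≤ s.rest.card * s.potential L lam +
        lam * ((lam - 1) * ∑ y ∈ s.rest, s.weight y * (k y * d)) := by
        have : 0 ≤ lam - 1 := by linarith
        gcongr with y _
        · exact hw y
        · exact h4 y
    _ = s.rest.card * s.potential L lam +
        (lam - 1) * d * (s.potential L lam - ∑ e, s.weight e) := by
        have : ∑ y ∈ s.rest, s.weight y * (k y * d) = d * ∑ y ∈ s.rest, s.weight y * k y := by
          rw [Finset.mul_sum]
          exact Finset.sum_congr rfl fun e _ => by ring
        rw [this, GreedyState.potential]
        ring
    _ ≤ _ := by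
        have : 0 ≤ (lam - 1) * d * ∑ e, s.weight e :=
          mul_nonneg (mul_nonneg (by linarith) hd0) hX
        linarith

/-- The indicator that `e` is alive with at least `d` alive neighbours. -/
noncomputable def GreedyState.heavy (L : SimpleGraph α) (s : GreedyState α) (e : α) (d : ℝ) : ℝ :=
  if e ∈ s.alive ∧ d ≤ ((nbrsIn L s.alive e).card : ℝ) then 1 else 0

theorem heavy_next_le (s : GreedyState α) (e y : α) (d : ℝ) :
    (s.next L lam y).heavy L e d ≤
      s.heavy L e d * if e ∈ (s.next L lam y).alive then 1 else 0 := by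
  unfold GreedyState.heavy
  by_cases h1 : e ∈ (s.next L lam y).alive ∧ d ≤ ((nbrsIn L (s.next L lam y).alive e).card : ℝ)
  · have hsub := next_alive_subset (L := L) (lam := lam) s y
    have := Finset.card_le_card (nbrsIn_mono (L := L) hsub e)
    have h2 : e ∈ s.alive ∧ d ≤ ((nbrsIn L s.alive e).card : ℝ) :=
      ⟨hsub h1.1, h1.2.trans (by exact_mod_cast this)⟩
    rw [if_pos h1, if_pos h2, if_pos h1.1]
    norm_num
  · rw [if_neg h1]
    split_ifs <;> norm_num

/-- Being heavy can only be lost, as the alive set shrinks, and at least `d` of the choices kill a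
heavy vertex. -/
theorem sum_heavy_next_le {s : GreedyState α} (h : s.alive ⊆ s.rest) (e : α) (d : ℝ) :
    ∑ y ∈ s.rest, (s.next L lam y).heavy L e d ≤ (s.rest.card - d) * s.heavy L e d := by
  refine (Finset.sum_le_sum fun y _ => heavy_next_le s e y d).trans ?_
  rw [← Finset.mul_sum, mul_comm]
  by_cases h1 : e ∈ s.alive ∧ d ≤ ((nbrsIn L s.alive e).card : ℝ)
  · have := card_alive_next_le (L := L) (lam := lam) h h1.1
    simp only [GreedyState.heavy, if_pos h1, mul_one]
    linarith [h1.2]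
  · simp [GreedyState.heavy, if_neg h1]

end Greedy

end MatchingQuery

namespace MatchingQuery

/-! ### Averages over all orders: balance, growth of the potential, Markov's inequality. -/

section GreedyRun

open Classical

variable {α : Type*} [Fintype α] {L : SimpleGraph α} {lam : ℝ} {m : ℕ}

theorem greedyRun_succ (π : Fin m ≃ α) (t : Fin m) :
    greedyRun L lam π (t + 1) = (greedyRun L lam π t).next L lam (π t) := by
  rw [greedyRun, dif_pos t.2]

theorem greedyRun_congr {π π' : Fin m ≃ α} (t : ℕ) (h : ∀ i : Fin m, i.val < t → π i = π' i) :
    greedyRun L lam π t = greedyRun L lam π' t := by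
  induction t with
  | zero => rfl
  | succ t ih =>
    have ih := ih fun i hi => h i (by omega)
    by_cases ht : t < m
    · rw [greedyRun_succ π ⟨t, ht⟩, greedyRun_succ π' ⟨t, ht⟩, ih, h ⟨t, ht⟩ (by simp)]
    · simp only [greedyRun, dif_neg ht, ih]

theorem mem_greedyRun_rest (π : Fin m ≃ α) (t : ℕ) (e : α) :
    e ∈ (greedyRun L lam π t).rest ↔ t ≤ (π.symm e).val := by
  induction t with
  | zero => simp [greedyRun]
  | succ t ih =>
    by_cases ht : t < m
    · rw [greedyRun_succ π ⟨t, ht⟩]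
      simp only [GreedyState.next, Finset.mem_erase, ih]
      constructor
      · rintro ⟨h1, h2⟩
        have : (π.symm e).val ≠ t := fun h => h1 (by
          rw [show (⟨t, ht⟩ : Fin m) = π.symm e from Fin.ext h.symm]; simp)
        omega
      · intro h
        refine ⟨?_, by omega⟩
        rintro rfl
        simp at h
    · simp only [greedyRun, dif_neg ht, ih]
      have := (π.symm e).2
      omega

theorem card_greedyRun_rest (π : Fin m ≃ α) (t : ℕ) :
    (greedyRun L lam π t).rest.card = m - t := by
  have : (greedyRun L lam π t).rest =
      (Finset.univ.filter fun j : Fin m => t ≤ j.val).map π.toEmbedding := by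
    ext e
    rw [mem_greedyRun_rest, Finset.mem_map_equiv]
    simp
  rw [this, Finset.card_map]
  have h2 : (Finset.univ.filter fun j : Fin m => t ≤ j.val) =
      Finset.univ.filter fun j : Fin m => ¬ (j.val < t) := by ext; simp
  have h3 := Finset.card_filter_add_card_filter_not (s := (Finset.univ : Finset (Fin m)))
    (fun j => j.val < t)
  rw [Fin.card_filter_val_lt, Finset.card_univ, Fintype.card_fin] at h3
  rw [h2]
  omega

theorem greedyRun_alive_subset_rest (π : Fin m ≃ α) (t : ℕ) :
    (greedyRun L lam π t).alive ⊆ (greedyRun L lam π t).rest := by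
  induction t with
  | zero => simp [greedyRun]
  | succ t ih =>
    by_cases ht : t < m
    · rw [greedyRun_succ π ⟨t, ht⟩]
      exact next_alive_subset_rest ih _
    · simpa only [greedyRun, dif_neg ht] using ih

theorem le_weight_next (hlam : 0 ≤ lam) {s : GreedyState α} (hs : ∀ e, 0 ≤ s.weight e) (y e : α) :
    s.weight e ≤ (s.next L lam y).weight e := by
  simp only [GreedyState.next]
  have := mul_nonneg hlam (hs y)
  split_ifs <;> linarith

theorem one_le_greedyRun_weight (hlam : 0 ≤ lam) (π : Fin m ≃ α) (t : ℕ) (e : α) :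
    1 ≤ (greedyRun L lam π t).weight e := by
  induction t generalizing e with
  | zero => simp [greedyRun]
  | succ t ih =>
    by_cases ht : t < m
    · rw [greedyRun_succ π ⟨t, ht⟩]
      exact (ih e).trans (le_weight_next hlam (fun e => zero_le_one.trans (ih e)) _ _)
    · simpa only [greedyRun, dif_neg ht] using ih e

theorem greedyRun_weight_mono (hlam : 0 ≤ lam) (π : Fin m ≃ α) (e : α) :
    Monotone fun t => (greedyRun L lam π t).weight e := by
  refine monotone_nat_of_le_succ fun t => ?_
  by_cases ht : t < m
  · rw [greedyRun_succ π ⟨t, ht⟩]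
    exact le_weight_next hlam
      (fun e => zero_le_one.trans (one_le_greedyRun_weight hlam π t e)) _ _
  · simp only [greedyRun, dif_neg ht, le_refl]

/-- One step of an average over all orders: the next vertex is uniform among the remaining ones. -/
theorem sum_orders_step_le (t : Fin m) {F F' : (Fin m ≃ α) → ℝ} {Φ : (Fin m ≃ α) → α → ℝ} {ρ : ℝ}
    (h1 : ∀ π π' : Fin m ≃ α, (∀ i, i < t → π' i = π i) → F' π' ≤ Φ π (π' t))
    (h2 : ∀ π, ∑ y ∈ (greedyRun L lam π t).rest, Φ π y ≤ ρ * F π) :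
    ((m : ℝ) - t) * ∑ π, F' π ≤ ρ * ∑ π, F π := by
  set J := Finset.univ.filter fun j : Fin m => t.val ≤ j.val with hJ
  have hcard : (J.card : ℝ) = (m : ℝ) - t := by
    have h3 := Finset.card_filter_add_card_filter_not (s := (Finset.univ : Finset (Fin m)))
      (fun j => j.val < t.val)
    rw [Fin.card_filter_val_lt, Finset.card_univ, Fintype.card_fin] at h3
    have h4 : J = Finset.univ.filter fun j : Fin m => ¬ (j.val < t.val) := by ext; simp [hJ]
    have ht := t.2
    rw [h4, eq_sub_iff_add_eq]
    have : (Finset.univ.filter fun j : Fin m => ¬ (j.val < t.val)).card + t.val = m := by omega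
    exact_mod_cast this
  -- Swapping positions `t` and `j` permutes the orders; for `j ≥ t` it fixes the prefix before `t`
  -- and puts `π j` at position `t`. Averaging over such `j` makes the next vertex uniform.
  have hswap : ∀ j : Fin m, ∑ π, F' π = ∑ π : Fin m ≃ α, F' ((Equiv.swap t j).trans π) := by
    intro j
    refine (Fintype.sum_equiv (Equiv.equivCongr (Equiv.swap t j) (Equiv.refl α)) _ _ ?_).symm
    intro π
    congr 1
  calc ((m : ℝ) - t) * ∑ π, F' π = ∑ j ∈ J, ∑ π, F' π := by
        rw [Finset.sum_const, nsmul_eq_mul, hcard]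
    _ = ∑ π : Fin m ≃ α, ∑ j ∈ J, F' ((Equiv.swap t j).trans π) := by
        exact (Finset.sum_congr rfl fun j _ => hswap j).trans Finset.sum_comm
    _ ≤ ∑ π : Fin m ≃ α, ∑ j ∈ J, Φ π (π j) := by
        refine Finset.sum_le_sum fun π _ => Finset.sum_le_sum fun j hj => ?_
        have hj' : t ≤ j := by simpa [hJ] using hj
        refine (h1 π _ fun i hi => ?_).trans_eq (by simp)
        simp only [Equiv.trans_apply]
        rw [Equiv.swap_apply_of_ne_of_ne hi.ne (hi.trans_le hj').ne]
    _ = ∑ π : Fin m ≃ α, ∑ y ∈ (greedyRun L lam π t).rest, Φ π y := by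
        refine Finset.sum_congr rfl fun π _ => ?_
        have : (greedyRun L lam π t).rest = J.map π.toEmbedding := by
          ext e
          rw [mem_greedyRun_rest, Finset.mem_map_equiv]
          simp [hJ]
        rw [this, Finset.sum_map]
        rfl
    _ ≤ ∑ π, ρ * F π := Finset.sum_le_sum fun π _ => h2 π
    _ = _ := by rw [Finset.mul_sum]

/-- A vertex with `d` alive neighbours is unlikely to be still alive after `t` steps. -/
theorem sum_heavy_greedyRun_le (e : α) {d : ℝ} (hd : 0 ≤ d) (t : ℕ) (ht : t ≤ m) :
    ∑ π : Fin m ≃ α, (greedyRun L lam π t).heavy L e d ≤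
      Real.exp (-(d * t / m)) * Fintype.card (Fin m ≃ α) := by
  have h0 : ∀ (s : GreedyState α), 0 ≤ s.heavy L e d := fun s => by
    unfold GreedyState.heavy; split_ifs <;> norm_num
  have h1 : ∀ (s : GreedyState α), s.heavy L e d ≤ 1 := fun s => by
    unfold GreedyState.heavy; split_ifs <;> norm_num
  induction t with
  | zero =>
    simp only [CharP.cast_eq_zero, mul_zero, zero_div, neg_zero, Real.exp_zero, one_mul]
    refine (Finset.sum_le_sum fun π _ => h1 _).trans ?_
    simp
  | succ t ih =>
    have ih := ih (by omega)
    have htm : t < m := by omega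
    have hpos : (0 : ℝ) < m - t := by
      have : (t : ℝ) < m := by exact_mod_cast htm
      linarith
    have hm : (0 : ℝ) < m := by
      have : (0 : ℝ) ≤ t := Nat.cast_nonneg t
      linarith
    have hstep := sum_orders_step_le (L := L) (lam := lam) (α := α) ⟨t, htm⟩
      (F := fun π => (greedyRun L lam π t).heavy L e d)
      (F' := fun π => (greedyRun L lam π (t + 1)).heavy L e d)
      (Φ := fun π y => ((greedyRun L lam π t).next L lam y).heavy L e d)
      (ρ := (m : ℝ) - t - d)
      (fun π π' h => by
        rw [greedyRun_succ π' ⟨t, htm⟩, greedyRun_congr (π := π') (π' := π) t fun i hi => h i hi])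
      (fun π => by
        refine (sum_heavy_next_le (greedyRun_alive_subset_rest π t) e d).trans_eq ?_
        rw [card_greedyRun_rest, Nat.cast_sub htm.le])
    set S := ∑ π : Fin m ≃ α, (greedyRun L lam π t).heavy L e d
    set S' := ∑ π : Fin m ≃ α, (greedyRun L lam π (t + 1)).heavy L e d
    have hS0 : 0 ≤ S := Finset.sum_nonneg fun π _ => h0 _
    have hexp : ((m : ℝ) - t - d) ≤ (m - t) * Real.exp (-(d / m)) := by
      have h3 : 1 - d / m ≤ Real.exp (-(d / m)) := by
        have := Real.add_one_le_exp (-(d / m)); linarith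
      have h4 : (m - t) * (d / m) ≤ d := by
        rw [mul_div_assoc', div_le_iff₀ hm]
        nlinarith [Nat.cast_nonneg (α := ℝ) t]
      nlinarith
    have h5 : ((m : ℝ) - t) * S' ≤ (m - t) * (Real.exp (-(d / m)) * S) := by
      calc _ ≤ ((m : ℝ) - t - d) * S := hstep
        _ ≤ (m - t) * Real.exp (-(d / m)) * S := mul_le_mul_of_nonneg_right hexp hS0
        _ = _ := by ring
    have h6 := le_of_mul_le_mul_left h5 hpos
    calc S' ≤ Real.exp (-(d / m)) * S := h6
      _ ≤ Real.exp (-(d / m)) * (Real.exp (-(d * t / m)) * Fintype.card (Fin m ≃ α)) := by gcongr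
      _ = _ := by
        rw [← mul_assoc, ← Real.exp_add]
        congr 2
        push_cast
        ring

/-- Before step `t` no alive vertex has had more than its share of alive neighbours. -/
def BalancedBefore (L : SimpleGraph α) (lam K : ℝ) (π : Fin m ≃ α) (t : ℕ) : Prop :=
  ∀ s, 1 ≤ s → s < t → ∀ f ∈ (greedyRun L lam π s).alive,
    ((nbrsIn L (greedyRun L lam π s).alive f).card : ℝ) ≤ K * m / (s + 1)

theorem potential_nonneg (hlam : 0 ≤ lam) (π : Fin m ≃ α) (t : ℕ) :
    0 ≤ (greedyRun L lam π t).potential L lam := by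
  have hw := fun e => zero_le_one.trans (one_le_greedyRun_weight (L := L) hlam π t e)
  unfold GreedyState.potential
  refine add_nonneg (Finset.sum_nonneg fun e _ => hw e)
    (mul_nonneg hlam (Finset.sum_nonneg fun e _ => mul_nonneg (hw e) (Nat.cast_nonneg _)))

theorem weight_le_potential (hlam : 0 ≤ lam) (π : Fin m ≃ α) (t : ℕ) (e : α) :
    (greedyRun L lam π t).weight e ≤ (greedyRun L lam π t).potential L lam := by
  have hw := fun e => zero_le_one.trans (one_le_greedyRun_weight (L := L) hlam π t e)
  unfold GreedyState.potential
  have h1 := Finset.single_le_sum (f := (greedyRun L lam π t).weight) (fun e _ => hw e)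
    (Finset.mem_univ e)
  have h2 := mul_nonneg hlam (Finset.sum_nonneg
    fun e (_ : e ∈ (greedyRun L lam π t).rest) => mul_nonneg (hw e)
      (Nat.cast_nonneg (α := ℝ) (nbrsIn L (greedyRun L lam π t).alive e).card))
  linarith

/-- Iterates the one-step drift. Orders that have become unbalanced are set to zero, so that the
degree bound is available at every step. -/
theorem sum_balanced_potential_le (hm : Fintype.card α = m) (hlam : 1 ≤ lam) {K : ℝ} (hK : 1 ≤ K)
    (t : ℕ) (ht : t ≤ m) :
    ∑ π : Fin m ≃ α, (if BalancedBefore L lam K π t then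
        (greedyRun L lam π t).potential L lam else 0) ≤
      Real.exp ((lam - 1) * K * ∑ s ∈ Finset.range t, (1 / ((s : ℝ) + 1) + 1 / (m - s))) *
        ((m + lam * m ^ 2) * Fintype.card (Fin m ≃ α)) := by
  have hlam0 : 0 ≤ lam := by linarith
  have hk : ∀ (A : Finset α) (e : α), ((nbrsIn L A e).card : ℝ) ≤ m := fun A e => by
    have := Finset.card_le_univ (nbrsIn L A e)
    rw [hm] at this
    exact_mod_cast this
  induction t with
  | zero =>
    simp only [Finset.range_zero, Finset.sum_empty, mul_zero, Real.exp_zero, one_mul]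
    have : ∀ π : Fin m ≃ α, (if BalancedBefore L lam K π 0 then
        (greedyRun L lam π 0).potential L lam else 0) ≤ m + lam * m ^ 2 := by
      intro π
      rw [if_pos (show BalancedBefore L lam K π 0 from fun s _ h => absurd h (Nat.not_lt_zero s))]
      simp only [greedyRun, GreedyState.potential, one_mul]
      have h1 : ∑ e : α, ((nbrsIn L Finset.univ e).card : ℝ) ≤ m ^ 2 := by
        refine (Finset.sum_le_sum fun e _ => hk _ e).trans_eq ?_
        rw [Finset.sum_const, Finset.card_univ, hm, nsmul_eq_mul]
        ring
      have h2 : ∑ e : α, (1 : ℝ) = m := by simp [hm]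
      rw [h2]
      gcongr
    refine (Finset.sum_le_sum fun π _ => this π).trans_eq ?_
    rw [Finset.sum_const, Finset.card_univ, nsmul_eq_mul]
    ring
  | succ t ih =>
    have ih := ih (by omega)
    have htm : t < m := by omega
    have hpos : (0 : ℝ) < m - t := by
      have : (t : ℝ) < m := by exact_mod_cast htm
      linarith
    have ht1 : (0 : ℝ) < t + 1 := by positivity
    have hK0 : (0 : ℝ) ≤ K := by linarith
    set d : ℝ := K * m / (t + 1) with hd
    have hd0 : 0 ≤ d := by positivity
    have hstep := sum_orders_step_le (L := L) (lam := lam) (α := α) ⟨t, htm⟩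
      (F := fun π => if BalancedBefore L lam K π t then
        (greedyRun L lam π t).potential L lam else 0)
      (F' := fun π => if BalancedBefore L lam K π (t + 1) then
        (greedyRun L lam π (t + 1)).potential L lam else 0)
      -- Balance before `t + 1` involves only the states up to `t`, so it is decided before the
      -- vertex at position `t` is drawn.
      (Φ := fun π y => if BalancedBefore L lam K π (t + 1) then
        ((greedyRun L lam π t).next L lam y).potential L lam else 0)
      (ρ := (m : ℝ) - t + (lam - 1) * d)
      (fun π π' h => by
        have hrun : ∀ s ≤ t, greedyRun L lam π' s = greedyRun L lam π s := fun s hs =>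
          greedyRun_congr s fun i hi => h i (Fin.lt_def.2 (lt_of_lt_of_le hi hs))
        have hb : BalancedBefore L lam K π' (t + 1) ↔ BalancedBefore L lam K π (t + 1) := by
          unfold BalancedBefore
          constructor <;> intro hB s h1 h2
          · rw [← hrun s (by omega)]; exact hB s h1 h2
          · rw [hrun s (by omega)]; exact hB s h1 h2
        simp only [hb]
        rw [greedyRun_succ π' ⟨t, htm⟩, hrun t le_rfl])
      (fun π => by
        by_cases hB : BalancedBefore L lam K π (t + 1)
        · have hB' : BalancedBefore L lam K π t := fun s h1 h2 => hB s h1 (by omega)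
          simp only [if_pos hB, if_pos hB']
          refine (sum_potential_next_le (d := d) (greedyRun_alive_subset_rest π t)
            (fun e => zero_le_one.trans (one_le_greedyRun_weight hlam0 π t e)) hlam ?_
            hd0).trans_eq ?_
          · intro f hf
            -- At `t = 0` the bound is trivial, `m ≤ K * m`; this is why balance is required only
            -- from step `1` on.
            rcases Nat.eq_zero_or_pos t with h0 | h0
            · refine (hk _ f).trans ?_
              rw [hd, h0]
              simp only [CharP.cast_eq_zero, zero_add, div_one]
              nlinarith [Nat.cast_nonneg (α := ℝ) m]
            · exact hB t h0 (by omega) f hf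
          · rw [card_greedyRun_rest, Nat.cast_sub htm.le]
        · simp only [if_neg hB, Finset.sum_const_zero]
          refine mul_nonneg (by nlinarith) ?_
          split_ifs
          · exact potential_nonneg hlam0 π t
          · exact le_rfl)
    set S := ∑ π : Fin m ≃ α, (if BalancedBefore L lam K π t then
        (greedyRun L lam π t).potential L lam else 0)
    set S' := ∑ π : Fin m ≃ α, (if BalancedBefore L lam K π (t + 1) then
        (greedyRun L lam π (t + 1)).potential L lam else 0)
    set a : ℝ := (lam - 1) * K * (1 / ((t : ℝ) + 1) + 1 / (m - t)) with ha
    have hS0 : 0 ≤ S := Finset.sum_nonneg fun π _ => by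
      split_ifs
      · exact potential_nonneg hlam0 π t
      · exact le_rfl
    have hrho : (m : ℝ) - t + (lam - 1) * d ≤ (m - t) * Real.exp a := by
      have h1 := Real.add_one_le_exp a
      have h2 : (lam - 1) * d ≤ (m - t) * a := by
        -- Partial fractions of `(m + 1) / ((t + 1) * (m - t))`, which leave two harmonic sums.
        have h3 : (m : ℝ) / (t + 1) ≤ (m - t) * (1 / ((t : ℝ) + 1) + 1 / (m - t)) := by
          have : (m - t) * (1 / ((t : ℝ) + 1) + 1 / (m - t)) = (m + 1) / (t + 1) := by
            field_simp
            ring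
          rw [this]
          gcongr
          linarith
        have h4 : 0 ≤ (lam - 1) * K := mul_nonneg (by linarith) hK0
        have := mul_le_mul_of_nonneg_left h3 h4
        rw [hd, ha]
        calc _ = (lam - 1) * K * (m / (t + 1)) := by ring
          _ ≤ _ := this
          _ = _ := by ring
      nlinarith
    have h5 : ((m : ℝ) - t) * S' ≤ (m - t) * (Real.exp a * S) := by
      calc _ ≤ ((m : ℝ) - t + (lam - 1) * d) * S := hstep
        _ ≤ (m - t) * Real.exp a * S := mul_le_mul_of_nonneg_right hrho hS0
        _ = _ := by ring
    have h6 := le_of_mul_le_mul_left h5 hpos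
    refine h6.trans ((mul_le_mul_of_nonneg_left ih (Real.exp_nonneg a)).trans_eq ?_)
    rw [← mul_assoc, ← Real.exp_add, Finset.sum_range_succ]
    congr 2
    rw [ha]
    ring

theorem sum_range_inv_add_inv_le (m : ℕ) :
    ∑ s ∈ Finset.range m, (1 / ((s : ℝ) + 1) + 1 / (m - s)) ≤ 2 * (1 + Real.log m) := by
  have h1 : ∑ s ∈ Finset.range m, 1 / ((s : ℝ) + 1) ≤ 1 + Real.log m := by
    refine le_trans (le_of_eq ?_) (harmonic_le_one_add_log m)
    simp [harmonic]
  have h2 : ∑ s ∈ Finset.range m, 1 / ((m : ℝ) - s) = ∑ s ∈ Finset.range m, 1 / ((s : ℝ) + 1) := by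
    rw [← Finset.sum_range_reflect]
    refine Finset.sum_congr rfl fun s hs => ?_
    have hs := Finset.mem_range.1 hs
    rw [show m - 1 - s = m - (s + 1) by omega, Nat.cast_sub (by omega)]
    push_cast
    congr 1
    ring
  rw [Finset.sum_add_distrib, h2]
  linarith

/-- Most orders are balanced. -/
theorem card_not_balanced_le (hm : Fintype.card α = m) {K : ℝ} (hK : 0 ≤ K) :
    ((Finset.univ.filter fun π : Fin m ≃ α => ¬ BalancedBefore L lam K π m).card : ℝ) ≤
      m ^ 2 * Real.exp (-(K / 2)) * Fintype.card (Fin m ≃ α) := by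
  have hh0 : ∀ (s : GreedyState α) e d, 0 ≤ s.heavy L e d := fun s e d => by
    unfold GreedyState.heavy; split_ifs <;> norm_num
  have hone : ∀ π : Fin m ≃ α, (if ¬ BalancedBefore L lam K π m then (1 : ℝ) else 0) ≤
      ∑ s ∈ Finset.Ico 1 m, ∑ e : α, (greedyRun L lam π s).heavy L e (K * m / (s + 1)) := by
    intro π
    have hsum0 : ∀ s, 0 ≤ ∑ e : α, (greedyRun L lam π s).heavy L e (K * m / (s + 1)) :=
      fun s => Finset.sum_nonneg fun e _ => hh0 _ _ _
    split_ifs with hbal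
    · exact Finset.sum_nonneg fun s _ => hsum0 s
    · unfold BalancedBefore at hbal
      push Not at hbal
      obtain ⟨s, hs1, hs2, f, hf, hlt⟩ := hbal
      have h2 : (greedyRun L lam π s).heavy L f (K * m / (s + 1)) = 1 := if_pos ⟨hf, hlt.le⟩
      refine h2.ge.trans (le_trans ?_ (Finset.single_le_sum
        (f := fun s : ℕ => ∑ e : α, (greedyRun L lam π s).heavy L e (K * m / (s + 1)))
        (fun s _ => hsum0 s) (Finset.mem_Ico.2 ⟨hs1, hs2⟩)))
      exact Finset.single_le_sum
        (f := fun e => (greedyRun L lam π s).heavy L e (K * m / (s + 1)))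
        (fun e _ => hh0 _ _ _) (Finset.mem_univ f)
  have hcard : ((Finset.univ.filter fun π : Fin m ≃ α => ¬ BalancedBefore L lam K π m).card : ℝ) =
      ∑ π : Fin m ≃ α, (if ¬ BalancedBefore L lam K π m then (1 : ℝ) else 0) := by
    rw [← Finset.sum_filter, Finset.sum_const, nsmul_eq_mul, mul_one]
  rw [hcard]
  refine (Finset.sum_le_sum fun π _ => hone π).trans ?_
  rw [Finset.sum_comm]
  set N : ℝ := (Fintype.card (Fin m ≃ α) : ℝ) with hN
  have hN0 : 0 ≤ N := Nat.cast_nonneg _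
  calc _ ≤ ∑ s ∈ Finset.Ico 1 m, (m * (Real.exp (-(K / 2)) * N)) := by
        refine Finset.sum_le_sum fun s hs => ?_
        have hs := Finset.mem_Ico.1 hs
        have hs1 : (1 : ℝ) ≤ s := by exact_mod_cast hs.1
        have hm0 : (0 : ℝ) < m := by exact_mod_cast (by omega : 0 < m)
        rw [Finset.sum_comm]
        have : ∀ e : α, ∑ π : Fin m ≃ α, (greedyRun L lam π s).heavy L e (K * m / (s + 1)) ≤
            Real.exp (-(K / 2)) * N := by
          intro e
          refine (sum_heavy_greedyRun_le e (by positivity) s hs.2.le).trans ?_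
          refine mul_le_mul_of_nonneg_right (Real.exp_le_exp.2 (neg_le_neg ?_)) hN0
          rw [show K * m / (s + 1) * s / m = K * (s / (s + 1)) by field_simp]
          -- Uses `s ≥ 1`; this is the source of the `K / 2` in the exponent.
          have : (1 : ℝ) / 2 ≤ s / (s + 1) := by
            rw [div_le_div_iff₀ (by norm_num) (by linarith)]
            linarith
          nlinarith
        refine (Finset.sum_le_sum fun e _ => this e).trans_eq ?_
        rw [Finset.sum_const, Finset.card_univ, hm, nsmul_eq_mul]
    _ ≤ m * (m * (Real.exp (-(K / 2)) * N)) := by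
        rw [Finset.sum_const, nsmul_eq_mul, Nat.card_Ico]
        gcongr
        omega
    _ = _ := by ring

/-- The average final potential over the balanced orders is quadratic. -/
theorem sum_balanced_potential_le_sq (hm : Fintype.card α = m) (hm1 : 1 ≤ m) {K : ℝ}
    (hK : 1 ≤ K) (hlam : lam = 1 + 1 / (2 * K * (1 + Real.log m))) :
    1 ≤ lam ∧ ∑ π : Fin m ≃ α, (if BalancedBefore L lam K π m then
        (greedyRun L lam π m).potential L lam else 0) ≤
      9 * m ^ 2 * Fintype.card (Fin m ≃ α) := by
  have hlog : 0 ≤ Real.log m := Real.log_nonneg (by exact_mod_cast hm1)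
  have hm1' : (1 : ℝ) ≤ m := by exact_mod_cast hm1
  have hden : 0 < 2 * K * (1 + Real.log m) := by positivity
  have hlam1 : 1 ≤ lam := by rw [hlam]; have := one_div_pos.2 hden; linarith
  have hlam2 : lam ≤ 2 := by
    rw [hlam]
    have : 1 / (2 * K * (1 + Real.log m)) ≤ 1 := by
      rw [div_le_one hden]
      nlinarith
    linarith
  refine ⟨hlam1, (sum_balanced_potential_le hm hlam1 hK m le_rfl).trans ?_⟩
  have h1 : Real.exp ((lam - 1) * K *
      ∑ s ∈ Finset.range m, (1 / ((s : ℝ) + 1) + 1 / (m - s))) ≤ 3 := by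
    have h1 : Real.exp 1 ≤ 3 := by linarith [Real.exp_one_lt_d9]
    refine le_trans (Real.exp_le_exp.2 ?_) h1
    have h0 : 0 ≤ (lam - 1) * K := mul_nonneg (by linarith) (by linarith)
    refine (mul_le_mul_of_nonneg_left (sum_range_inv_add_inv_le m) h0).trans_eq ?_
    -- `lam` is chosen so that the exponent is exactly `1`.
    rw [hlam]
    field_simp
    ring
  have h2 : (m : ℝ) + lam * m ^ 2 ≤ 3 * m ^ 2 := by nlinarith
  calc _ ≤ 3 * (3 * m ^ 2 * (Fintype.card (Fin m ≃ α) : ℝ)) := by gcongr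
    _ = _ := by ring

/-- For most orders all final weights are polynomially bounded. -/
theorem card_orders_exists_weight_gt_le (hm : Fintype.card α = m) (hm1 : 1 ≤ m) {K : ℝ}
    (hK : 1 ≤ K) (hlam : lam = 1 + 1 / (2 * K * (1 + Real.log m))) {x : ℝ} (hx : 0 < x)
    (T : Finset (Fin m ≃ α)) (hT : ∀ π ∈ T, ∃ e, x < (greedyRun L lam π m).weight e) :
    (T.card : ℝ) ≤
      (m ^ 2 * Real.exp (-(K / 2)) + 9 * m ^ 2 / x) * Nat.card (Fin m ≃ α) := by
  rw [Nat.card_eq_fintype_card]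
  obtain ⟨hlam1, hB⟩ := sum_balanced_potential_le_sq (L := L) hm hm1 hK hlam
  have hlam0 : 0 ≤ lam := by linarith
  have hA := card_not_balanced_le (L := L) (lam := lam) hm (zero_le_one.trans hK)
  set N : ℝ := (Fintype.card (Fin m ≃ α) : ℝ)
  set S := Finset.univ.filter fun π : Fin m ≃ α =>
    BalancedBefore L lam K π m ∧ x < (greedyRun L lam π m).potential L lam with hS
  have hsub : T ⊆
      (Finset.univ.filter fun π : Fin m ≃ α => ¬ BalancedBefore L lam K π m) ∪ S := by
    intro π hπ
    obtain ⟨e, he⟩ := hT π hπ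
    by_cases hbal : BalancedBefore L lam K π m
    · exact Finset.mem_union_right _ (Finset.mem_filter.2 ⟨Finset.mem_univ _, hbal,
        he.trans_le (weight_le_potential hlam0 π m e)⟩)
    · exact Finset.mem_union_left _ (Finset.mem_filter.2 ⟨Finset.mem_univ _, hbal⟩)
  have hSx : (S.card : ℝ) * x ≤ 9 * m ^ 2 * N := by
    rw [← nsmul_eq_mul]
    refine (Finset.card_nsmul_le_sum S (fun π : Fin m ≃ α => if BalancedBefore L lam K π m then
        (greedyRun L lam π m).potential L lam else 0) x fun π hπ => ?_).trans
      ((Finset.sum_le_univ_sum_of_nonneg fun π => ?_).trans hB)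
    · have := (Finset.mem_filter.1 hπ).2
      simp only [if_pos this.1]
      exact this.2.le
    · split_ifs
      · exact potential_nonneg hlam0 π m
      · exact le_rfl
  have hS' : (S.card : ℝ) ≤ 9 * m ^ 2 / x * N := by
    rw [div_mul_eq_mul_div, le_div_iff₀ hx]
    exact hSx
  have hc := (Finset.card_le_card hsub).trans (Finset.card_union_le _ _)
  have hc' : (T.card : ℝ) ≤
      (Finset.univ.filter fun π : Fin m ≃ α => ¬ BalancedBefore L lam K π m).card + S.card := by
    exact_mod_cast hc
  linarith

end GreedyRun

end MatchingQuery

namespace MatchingQuery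

/-! ### Result and cost of a sequential scan. -/

section Scan

theorem scan_map {α β : Type*} (q : β → Bool × ℕ) (f : α → β) (l : List α) :
    scan q (l.map f) = ((scan (q ∘ f) l).1.map f, (scan (q ∘ f) l).2) := by
  induction l with
  | nil => rfl
  | cons a l ih =>
    simp only [List.map_cons, scan, ih, Function.comp_apply]
    split_ifs <;> rfl

theorem scan_attach {α : Type*} (q : α → Bool × ℕ) (l : List α) :
    scan q l = ((scan (fun j : {j // j ∈ l} => q j.1) l.attach).1.map Subtype.val,
      (scan (fun j : {j // j ∈ l} => q j.1) l.attach).2) := by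
  have := scan_map q (Subtype.val : {j // j ∈ l} → α) l.attach
  rw [List.attach_map_subtype_val] at this
  exact this

theorem scan_fst_isNone {α : Type*} (q : α → Bool × ℕ) (l : List α) :
    (scan q l).1.isNone = true ↔ ∀ a ∈ l, (q a).1 = false := by
  induction l with
  | nil => simp [scan]
  | cons a l ih =>
    simp only [scan, List.mem_cons, forall_eq_or_imp]
    split_ifs with h
    · simp [h]
    · rw [ih]; simp [h]

theorem scan_fst_eq_some {α : Type*} {q : α → Bool × ℕ} {l : List α} {a : α}
    (h : (scan q l).1 = some a) : a ∈ l ∧ (q a).1 = true := by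
  induction l with
  | nil => simp [scan] at h
  | cons b l ih =>
    simp only [scan] at h
    split_ifs at h with hb
    · obtain rfl : b = a := by simpa using h
      exact ⟨List.mem_cons_self, hb⟩
    · exact ⟨List.mem_cons_of_mem _ (ih h).1, (ih h).2⟩

/-- On a sorted list the first positive member is the least one. -/
theorem scan_fst_eq_some_of_least {α : Type*} [LinearOrder α] {q : α → Bool × ℕ} {l : List α}
    (hl : l.SortedLT) {a : α} (ha : a ∈ l) (hqa : (q a).1 = true)
    (hlt : ∀ b ∈ l, b < a → (q b).1 = false) : (scan q l).1 = some a := by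
  induction l with
  | nil => simp at ha
  | cons b l ih =>
    have hp := List.pairwise_cons.1 hl.pairwise
    simp only [scan]
    rcases List.mem_cons.1 ha with rfl | ha'
    · rw [if_pos hqa]
    · rw [if_neg (by simp [hlt b List.mem_cons_self (hp.1 a ha')])]
      exact ih hp.2.sortedLT ha' fun c hc => hlt c (List.mem_cons_of_mem _ hc)

open Classical in
/-- On a sorted list the cost of a scan is that of the members not preceded by a positive one. -/
theorem scan_snd {α : Type*} [LinearOrder α] (q : α → Bool × ℕ) {l : List α}
    (hl : l.SortedLT) :
    (scan q l).2 = ∑ a ∈ l.toFinset.filter (fun a => ∀ b ∈ l, b < a → (q b).1 = false),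
      (q a).2 := by
  induction l with
  | nil => simp [scan]
  | cons b l ih =>
    have hp := List.pairwise_cons.1 hl.pairwise
    have hbl : b ∉ l := fun h => lt_irrefl _ (hp.1 b h)
    simp only [scan]
    split_ifs with hb
    · have : (b :: l).toFinset.filter
          (fun a => ∀ c ∈ b :: l, c < a → (q c).1 = false) = {b} := by
        ext a
        simp only [Finset.mem_filter, List.mem_toFinset, Finset.mem_singleton]
        constructor
        · rintro ⟨h1, h2⟩
          rcases List.mem_cons.1 h1 with h | h
          · exact h
          · have := h2 b List.mem_cons_self (hp.1 a h)
            simp [hb] at this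
        · rintro rfl
          refine ⟨List.mem_cons_self, fun c hc hlt => ?_⟩
          rcases List.mem_cons.1 hc with rfl | h
          · exact absurd hlt (lt_irrefl _)
          · exact absurd hlt (hp.1 c h).asymm
      rw [this, Finset.sum_singleton]
    · have hbf : (q b).1 = false := by simpa using hb
      have : (b :: l).toFinset.filter
          (fun a => ∀ c ∈ b :: l, c < a → (q c).1 = false) =
          insert b (l.toFinset.filter (fun a => ∀ c ∈ l, c < a → (q c).1 = false)) := by
        ext a
        simp only [Finset.mem_filter, List.mem_toFinset, Finset.mem_insert, List.mem_cons]
        constructor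
        · rintro ⟨rfl | h1, h2⟩
          · exact Or.inl rfl
          · exact Or.inr ⟨h1, fun c hc => h2 c (Or.inr hc)⟩
        · rintro (rfl | ⟨h1, h2⟩)
          · refine ⟨Or.inl rfl, fun c hc hlt => ?_⟩
            rcases hc with rfl | h
            · exact hbf
            · exact absurd hlt (hp.1 c h).asymm
          · refine ⟨Or.inr h1, fun c hc hlt => ?_⟩
            rcases hc with rfl | h
            · exact hbf
            · exact h2 c h hlt
      rw [this, Finset.sum_insert (by simp [hbl]), ih hp.2.sortedLT]

end Scan

/-! ### Query trees and their shrinking under one application. -/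

section EdgeQuery

variable {V : Type*} {G : SimpleGraph V}

/-- The edges of ranks `i` and `j` have a common endpoint. -/
def Touching (π : EdgeOrder G) (i j : Fin G.edgeSet.ncard) : Prop :=
  ∃ v : V, v ∈ (π i : Sym2 V) ∧ v ∈ (π j : Sym2 V)

theorem Touching.symm {π : EdgeOrder G} {i j : Fin G.edgeSet.ncard} (h : Touching π i j) :
    Touching π j i :=
  let ⟨v, h1, h2⟩ := h
  ⟨v, h2, h1⟩

/-- The edge of rank `i` is found to be matched by its edge query. -/
def IsMatched (π : EdgeOrder G) (H : SimpleGraph V) (i : Fin G.edgeSet.ncard) : Prop :=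
  (edgeQuery π H i).1 = true

open Classical in
/-- The edges queried directly by the edge query of the edge of rank `i`. -/
noncomputable def children (π : EdgeOrder G) (H : SimpleGraph V) (i : Fin G.edgeSet.ncard) :
    Finset (Fin G.edgeSet.ncard) :=
  Finset.univ.filter fun j => j < i ∧ (π j : Sym2 V) ∈ H.edgeSet ∧ Touching π i j ∧
    ∀ k, k < j → (π k : Sym2 V) ∈ H.edgeSet → Touching π i k → ¬ IsMatched π H k

theorem mem_children {π : EdgeOrder G} {H : SimpleGraph V} {i j : Fin G.edgeSet.ncard} :
    j ∈ children π H i ↔ j < i ∧ (π j : Sym2 V) ∈ H.edgeSet ∧ Touching π i j ∧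
      ∀ k, k < j → (π k : Sym2 V) ∈ H.edgeSet → Touching π i k → ¬ IsMatched π H k := by
  simp [children]

theorem mem_earlierEdges {π : EdgeOrder G} {H : SimpleGraph V} {i j : Fin G.edgeSet.ncard} :
    j ∈ earlierEdges π H i ↔ j < i ∧ (π j : Sym2 V) ∈ H.edgeSet ∧ Touching π i j := by
  simp [earlierEdges, Touching]

theorem mem_edgesAt {π : EdgeOrder G} {H : SimpleGraph V} {v : V} {j : Fin G.edgeSet.ncard} :
    j ∈ edgesAt π H v ↔ (π j : Sym2 V) ∈ H.edgeSet ∧ v ∈ (π j : Sym2 V) := by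
  simp [edgesAt]

theorem edgeQuery_eq (π : EdgeOrder G) (H : SimpleGraph V) (i : Fin G.edgeSet.ncard) :
    edgeQuery π H i = ((scan (edgeQuery π H) (earlierEdges π H i)).1.isNone,
      (scan (edgeQuery π H) (earlierEdges π H i)).2 + 1) := by
  rw [edgeQuery, scan_attach (edgeQuery π H)]
  simp

theorem isMatched_iff (π : EdgeOrder G) (H : SimpleGraph V) (i : Fin G.edgeSet.ncard) :
    IsMatched π H i ↔
      ∀ j, j < i → (π j : Sym2 V) ∈ H.edgeSet → Touching π i j → ¬ IsMatched π H j := by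
  rw [IsMatched, edgeQuery_eq, scan_fst_isNone]
  simp only [mem_earlierEdges, IsMatched, Bool.not_eq_true]
  exact ⟨fun h j h1 h2 h3 => h j ⟨h1, h2, h3⟩, fun h j hj => h j hj.1 hj.2.1 hj.2.2⟩

theorem edgeQuery_snd (π : EdgeOrder G) (H : SimpleGraph V) (i : Fin G.edgeSet.ncard) :
    (edgeQuery π H i).2 = 1 + ∑ j ∈ children π H i, (edgeQuery π H j).2 := by
  have hs : (earlierEdges π H i).SortedLT := Finset.sortedLT_sort _
  have h1 : (edgeQuery π H i).2 = 1 + (scan (edgeQuery π H) (earlierEdges π H i)).2 := by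
    rw [edgeQuery_eq, add_comm]
  rw [h1, scan_snd _ hs]
  congr 1
  refine Finset.sum_congr (M := ℕ) ?_ fun _ _ => rfl
  ext j
  simp only [Finset.mem_filter, List.mem_toFinset, mem_earlierEdges, mem_children, IsMatched,
    Bool.not_eq_true]
  constructor
  · rintro ⟨⟨h1, h2, h3⟩, h4⟩
    exact ⟨h1, h2, h3, fun k hk hH ht => h4 k ⟨hk.trans h1, hH, ht⟩ hk⟩
  · rintro ⟨h1, h2, h3, h4⟩
    exact ⟨⟨h1, h2, h3⟩, fun k hk hlt => h4 k hlt hk.2.1 hk.2.2⟩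

theorem one_le_edgeQuery_snd (π : EdgeOrder G) (H : SimpleGraph V) (i : Fin G.edgeSet.ncard) :
    1 ≤ (edgeQuery π H i).2 := by
  rw [edgeQuery_snd]; omega

/-- Distinct matched edges do not touch. -/
theorem IsMatched.eq_of_touching {π : EdgeOrder G} {H : SimpleGraph V}
    {i j : Fin G.edgeSet.ncard} (hi : IsMatched π H i) (hj : IsMatched π H j)
    (hiH : (π i : Sym2 V) ∈ H.edgeSet) (hjH : (π j : Sym2 V) ∈ H.edgeSet)
    (h : Touching π i j) : i = j := by
  rcases lt_trichotomy i j with hlt | heq | hlt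
  · exact absurd hi ((isMatched_iff π H j).1 hj i hlt hiH h.symm)
  · exact heq
  · exact absurd hj ((isMatched_iff π H i).1 hi j hlt hjH h)

theorem mem_edgeSet_step {π : EdgeOrder G} {B : ℝ} {H : SimpleGraph V} {e : Sym2 V} :
    e ∈ (step π B H).edgeSet ↔ e ∈ H.edgeSet ∧ ∀ v ∈ e, ¬ KnownMatched π B H v := by
  induction e with
  | _ a b => simp [step]

theorem KnownMatched.exists_isMatched {π : EdgeOrder G} {B : ℝ} {H : SimpleGraph V} {w : V}
    (h : KnownMatched π B H w) : ∃ i, IsMatched π H i ∧ (π i : Sym2 V) ∈ H.edgeSet ∧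
      w ∈ (π i : Sym2 V) ∧ ∀ v ∈ (π i : Sym2 V), KnownMatched π B H v := by
  obtain ⟨v, i, h1, h2⟩ := h
  have h3 := h1
  unfold truncatedVertexQuery at h3
  split_ifs at h3
  have h4 := scan_fst_eq_some (Option.some.inj h3)
  exact ⟨i, h4.2, (mem_edgesAt.1 h4.1).1, h2, fun u hu => ⟨v, i, h1, hu⟩⟩

/-- A matched edge that touches a surviving edge survives. -/
theorem mem_step_of_isMatched {π : EdgeOrder G} {B : ℝ} {H : SimpleGraph V}
    {i j : Fin G.edgeSet.ncard} (hi : (π i : Sym2 V) ∈ (step π B H).edgeSet)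
    (hj : (π j : Sym2 V) ∈ H.edgeSet) (hm : IsMatched π H j) (h : Touching π i j) :
    (π j : Sym2 V) ∈ (step π B H).edgeSet := by
  refine mem_edgeSet_step.2 ⟨hj, fun v hv hk => ?_⟩
  obtain ⟨k, hkm, hkH, hvk, hall⟩ := hk.exists_isMatched
  obtain rfl := hkm.eq_of_touching hm hkH hj ⟨v, hvk, hv⟩
  obtain ⟨w, hwi, hwj⟩ := h
  exact (mem_edgeSet_step.1 hi).2 w hwi (hall w hwj)

/-- By induction on the rank: a matched edge that blocks a surviving edge survives too, since
deleting it would delete the common endpoint. -/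
theorem isMatched_step_iff {π : EdgeOrder G} {B : ℝ} {H : SimpleGraph V}
    (i : Fin G.edgeSet.ncard) (hi : (π i : Sym2 V) ∈ (step π B H).edgeSet) :
    IsMatched π (step π B H) i ↔ IsMatched π H i := by
  induction i using WellFoundedLT.induction with
  | ind i ih =>
    rw [isMatched_iff, isMatched_iff]
    constructor
    · intro h j hlt hj ht hm
      have hj' := mem_step_of_isMatched hi hj hm ht
      exact h j hlt hj' ht ((ih j hlt hj').2 hm)
    · intro h j hlt hj ht hm
      exact h j hlt (mem_edgeSet_step.1 hj).1 ht ((ih j hlt hj).1 hm)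

/-- The matched neighbour that stops the scan in `H` survives with its status, so the new scan does
not run past it. -/
theorem children_step_subset {π : EdgeOrder G} {B : ℝ} {H : SimpleGraph V}
    {i : Fin G.edgeSet.ncard} (hi : (π i : Sym2 V) ∈ (step π B H).edgeSet) :
    children π (step π B H) i ⊆ children π H i := by
  intro j hj
  obtain ⟨h1, h2, h3, h4⟩ := mem_children.1 hj
  refine mem_children.2 ⟨h1, (mem_edgeSet_step.1 h2).1, h3, fun k hk hkH ht hm => ?_⟩
  have hk' := mem_step_of_isMatched hi hkH hm ht
  exact h4 k hk hk' ht ((isMatched_step_iff k hk').2 hm)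

/-- The vertex query of an endpoint of a matched edge ends with this edge, at about the cost of its
edge query. -/
theorem vertexQuery_of_isMatched {π : EdgeOrder G} {H : SimpleGraph V}
    {f : Fin G.edgeSet.ncard} (hf : (π f : Sym2 V) ∈ H.edgeSet) (hm : IsMatched π H f) {v : V}
    (hv : v ∈ (π f : Sym2 V)) :
    (vertexQuery π H v).1 = some f ∧ (vertexQuery π H v).2 ≤ 2 * (edgeQuery π H f).2 := by
  have hs : (edgesAt π H v).SortedLT := Finset.sortedLT_sort _
  have hmem : f ∈ edgesAt π H v := mem_edgesAt.2 ⟨hf, hv⟩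
  have hlt : ∀ b ∈ edgesAt π H v, b < f → ¬ IsMatched π H b := fun b hb hbf =>
    (isMatched_iff π H f).1 hm b hbf (mem_edgesAt.1 hb).1 ⟨v, hv, (mem_edgesAt.1 hb).2⟩
  refine ⟨scan_fst_eq_some_of_least hs hmem hm fun b hb hbf => by
    simpa [IsMatched] using hlt b hb hbf, ?_⟩
  classical
  rw [vertexQuery, scan_snd _ hs]
  -- The edges at `v` preceding `f` are also queried by `f` itself, since a matched edge queries all
  -- its earlier neighbours. Their total cost is thus below that of `f`, whence the factor `2`.
  refine (Finset.sum_le_sum_of_subset (M := ℕ) (t := insert f (children π H f)) ?_).trans ?_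
  · intro a ha
    simp only [Finset.mem_filter, List.mem_toFinset] at ha
    obtain ⟨ha, hb⟩ := ha
    rcases lt_trichotomy a f with h | h | h
    · refine Finset.mem_insert_of_mem (mem_children.2 ⟨h, (mem_edgesAt.1 ha).1,
        ⟨v, hv, (mem_edgesAt.1 ha).2⟩, fun k hk hkH ht =>
        (isMatched_iff π H f).1 hm k (hk.trans h) hkH ht⟩)
    · exact h ▸ Finset.mem_insert_self _ _
    · have h1 := hb f hmem h
      have h2 : (edgeQuery π H f).1 = true := hm
      rw [h2] at h1
      exact absurd h1 (by decide)
  have h1 := edgeQuery_snd π H f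
  have h2 : f ∉ children π H f := fun h => lt_irrefl _ (mem_children.1 h).1
  rw [Finset.sum_insert h2]
  omega

/-- An edge with a small query tree is removed. -/
theorem notMem_step_of_edgeQuery_le {π : EdgeOrder G} {B : ℝ} {H : SimpleGraph V}
    {i : Fin G.edgeSet.ncard} (hi : (π i : Sym2 V) ∈ H.edgeSet)
    (hB : 2 * ((edgeQuery π H i).2 : ℝ) ≤ B) : (π i : Sym2 V) ∉ (step π B H).edgeSet := by
  have key : ∀ f, (π f : Sym2 V) ∈ H.edgeSet → IsMatched π H f →
      (edgeQuery π H f).2 ≤ (edgeQuery π H i).2 → ∀ v ∈ (π f : Sym2 V),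
      KnownMatched π B H v := by
    intro f hf hm hle v hv
    obtain ⟨h1, h2⟩ := vertexQuery_of_isMatched hf hm hv
    refine ⟨v, f, ?_, hv⟩
    rw [truncatedVertexQuery, if_pos, h1]
    have h3 : ((vertexQuery π H v).2 : ℝ) ≤ 2 * (edgeQuery π H i).2 := by
      exact_mod_cast h2.trans (Nat.mul_le_mul_left 2 hle)
    exact h3.trans hB
  intro hmem
  have hno := (mem_edgeSet_step.1 hmem).2
  by_cases hm : IsMatched π H i
  · obtain ⟨v, hv⟩ : ∃ v, v ∈ (π i : Sym2 V) := by
      generalize (π i : Sym2 V) = e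
      induction e with
      | _ a b => exact ⟨a, Sym2.mem_mk_left a b⟩
    exact hno v hv (key i hi hm le_rfl v hv)
  · classical
    -- The lowest matched edge touching `i` is a child of `i`, so its tree is no larger, and its
    -- discovery deletes the common endpoint.
    have hex : (Finset.univ.filter fun j => j < i ∧ (π j : Sym2 V) ∈ H.edgeSet ∧
        Touching π i j ∧ IsMatched π H j).Nonempty := by
      rw [isMatched_iff] at hm
      push Not at hm
      obtain ⟨j, h1, h2, h3, h4⟩ := hm
      exact ⟨j, by simp [h1, h2, h3, h4]⟩
    obtain ⟨f, hf, hmin⟩ := Finset.exists_min_image _ id hex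
    obtain ⟨h1, h2, h3, h4⟩ := (Finset.mem_filter.1 hf).2
    have hch : f ∈ children π H i := mem_children.2 ⟨h1, h2, h3, fun k hk hkH ht hkm =>
      absurd (hmin k (Finset.mem_filter.2 ⟨Finset.mem_univ _, hk.trans h1, hkH, ht, hkm⟩))
        (not_le.2 hk)⟩
    have hle : (edgeQuery π H f).2 ≤ (edgeQuery π H i).2 := by
      rw [edgeQuery_snd π H i]
      have := Finset.single_le_sum (f := fun j => (edgeQuery π H j).2)
        (fun j _ => Nat.zero_le _) hch
      omega
    obtain ⟨v, hvi, hvf⟩ := h3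
    exact hno v hvi (key f h2 h4 hle v hvf)

/-- If the query trees have small depth, then one step shrinks those of the surviving edges. -/
theorem edgeQuery_step_le {π : EdgeOrder G} {B : ℝ} {H : SimpleGraph V}
    {δ : Fin G.edgeSet.ncard → ℝ} (hδ1 : ∀ i, 1 ≤ δ i)
    (hδ : ∀ i j, (π i : Sym2 V) ∈ H.edgeSet → j ∈ children π H i → δ j + 1 ≤ δ i)
    (i : Fin G.edgeSet.ncard) (hi : (π i : Sym2 V) ∈ (step π B H).edgeSet) :
    B / 2 * ((edgeQuery π (step π B H) i).2 : ℝ) ≤ δ i * (edgeQuery π H i).2 := by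
  induction i using WellFoundedLT.induction with
  | ind i ih =>
    have hiH := (mem_edgeSet_step.1 hi).1
    have hB : B / 2 ≤ (edgeQuery π H i).2 := by
      by_contra hlt
      exact notMem_step_of_edgeQuery_le hiH (by linarith [not_le.1 hlt]) hi
    have h1 : ((edgeQuery π H i).2 : ℝ) = 1 + ∑ j ∈ children π H i, ((edgeQuery π H j).2 : ℝ) := by
      rw [edgeQuery_snd]; push_cast; rfl
    -- `δ` bounds the depth of the tree. The levels below the root contribute `δ i - 1` times the
    -- old size; the root's own `B / 2` is paid by `hB`.
    have hsum : ∑ j ∈ children π (step π B H) i,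
        B / 2 * ((edgeQuery π (step π B H) j).2 : ℝ) ≤
        (δ i - 1) * ∑ j ∈ children π H i, ((edgeQuery π H j).2 : ℝ) := by
      rw [Finset.mul_sum]
      refine (Finset.sum_le_sum fun j hj => ?_).trans
        (Finset.sum_le_sum_of_subset_of_nonneg (children_step_subset hi) fun j _ _ =>
          mul_nonneg (by linarith [hδ1 i]) (Nat.cast_nonneg _))
      have hj' := mem_children.1 hj
      refine (ih j hj'.1 hj'.2.1).trans ?_
      have := hδ i j hiH (children_step_subset hi hj)
      exact mul_le_mul_of_nonneg_right (by linarith) (Nat.cast_nonneg _)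
    rw [edgeQuery_snd π (step π B H) i]
    push_cast
    rw [mul_add, Finset.mul_sum]
    have := hδ1 i
    nlinarith

/-- After `k` steps the query trees of the surviving edges have shrunk by the `k`-th power. -/
theorem edgeQuery_iterate_step_le {π : EdgeOrder G} {B D x : ℝ} (hB : 0 < B)
    {δ : Fin G.edgeSet.ncard → ℝ} (hδ1 : ∀ i, 1 ≤ δ i) (hδD : ∀ i, δ i ≤ D)
    (hδ : ∀ i j, j ∈ children π G i → δ j + 1 ≤ δ i)
    (hx : ∀ i, ((edgeQuery π G i).2 : ℝ) ≤ x) (k : ℕ) :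
    ∀ i, (π i : Sym2 V) ∈ ((step π B)^[k] G).edgeSet →
      children π ((step π B)^[k] G) i ⊆ children π G i ∧
      (B / 2) ^ k * ((edgeQuery π ((step π B)^[k] G) i).2 : ℝ) ≤ D ^ k * x := by
  induction k with
  | zero => intro i _; simpa using hx i
  | succ k ih =>
    intro i hi
    rw [Function.iterate_succ_apply'] at hi ⊢
    have hiH := (mem_edgeSet_step.1 hi).1
    refine ⟨(children_step_subset hi).trans (ih i hiH).1, ?_⟩
    have h1 := edgeQuery_step_le hδ1 (fun i j hi hj => hδ i j ((ih i hi).1 hj)) i hi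
    have h2 := (ih i hiH).2
    have hD : 0 ≤ D := by linarith [hδ1 i, hδD i]
    calc (B / 2) ^ (k + 1) * ((edgeQuery π (step π B ((step π B)^[k] G)) i).2 : ℝ)
        = (B / 2) ^ k * (B / 2 * (edgeQuery π (step π B ((step π B)^[k] G)) i).2) := by ring
      _ ≤ (B / 2) ^ k * (D * (edgeQuery π ((step π B)^[k] G) i).2) := by
          refine mul_le_mul_of_nonneg_left (h1.trans ?_) (by positivity)
          exact mul_le_mul_of_nonneg_right (hδD i) (Nat.cast_nonneg _)
      _ = D * ((B / 2) ^ k * (edgeQuery π ((step π B)^[k] G) i).2) := by ring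
      _ ≤ D * (D ^ k * x) := mul_le_mul_of_nonneg_left h2 hD
      _ = _ := by ring

theorem iterate_step_le (π : EdgeOrder G) (B : ℝ) (k : ℕ) : (step π B)^[k] G ≤ G := by
  induction k with
  | zero => exact le_rfl
  | succ k ih =>
    rw [Function.iterate_succ_apply']
    exact fun a b h => ih h.1

theorem iterate_step_eq_bot {π : EdgeOrder G} {B D x : ℝ} (hB : 0 < B)
    {δ : Fin G.edgeSet.ncard → ℝ} (hδ1 : ∀ i, 1 ≤ δ i) (hδD : ∀ i, δ i ≤ D)
    (hδ : ∀ i j, j ∈ children π G i → δ j + 1 ≤ δ i)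
    (hx : ∀ i, ((edgeQuery π G i).2 : ℝ) ≤ x) {k : ℕ} (hk : D ^ k * x < (B / 2) ^ k) :
    (step π B)^[k] G = ⊥ := by
  rw [← SimpleGraph.edgeSet_eq_empty, Set.eq_empty_iff_forall_notMem]
  intro e he
  have heG : e ∈ G.edgeSet := SimpleGraph.edgeSet_mono (iterate_step_le π B k) he
  have hpi : ((π (π.symm ⟨e, heG⟩)) : Sym2 V) = e := by simp
  have h1 := (edgeQuery_iterate_step_le hB hδ1 hδD hδ hx k (π.symm ⟨e, heG⟩) (by rwa [hpi])).2
  have h2 : (1 : ℝ) ≤ (edgeQuery π ((step π B)^[k] G) (π.symm ⟨e, heG⟩)).2 := by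
    exact_mod_cast one_le_edgeQuery_snd _ _ _
  have h3 : 0 < (B / 2) ^ k := by positivity
  nlinarith

end EdgeQuery

end MatchingQuery

namespace MatchingQuery

/-! ### Query trees against greedy weights on the line graph. -/

section Link

variable {V : Type*} {G : SimpleGraph V} [Fintype G.edgeSet] {lam : ℝ}

theorem touching_iff_eq_or_adj {π : EdgeOrder G} {i j : Fin G.edgeSet.ncard} :
    Touching π i j ↔ π i = π j ∨ G.lineGraph.Adj (π i) (π j) := by
  rw [SimpleGraph.lineGraph_adj_iff_exists, Touching]
  constructor
  · intro h
    by_cases heq : π i = π j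
    · exact Or.inl heq
    · exact Or.inr ⟨heq, h⟩
  · rintro (heq | h)
    · rw [heq]
      generalize (π j : Sym2 V) = e
      induction e with
      | _ a b => exact ⟨a, Sym2.mem_mk_left a b, Sym2.mem_mk_left a b⟩
    · exact h.2

/-- The alive vertices of the greedy process on the line graph are the edges that do not touch an
earlier matched edge. -/
theorem mem_alive_iff (π : EdgeOrder G) (i : Fin G.edgeSet.ncard) (t : ℕ)
    (ht : t ≤ G.edgeSet.ncard) :
    π i ∈ (greedyRun G.lineGraph lam π t).alive ↔
      ∀ k : Fin G.edgeSet.ncard, k.val < t → Touching π i k → ¬ IsMatched π G k := by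
  induction t generalizing i with
  | zero => simp [greedyRun]
  | succ t ih =>
    have htm : t < G.edgeSet.ncard := by omega
    have hmatch : π ⟨t, htm⟩ ∈ (greedyRun G.lineGraph lam π t).alive ↔ IsMatched π G ⟨t, htm⟩ := by
      rw [ih ⟨t, htm⟩ htm.le, isMatched_iff]
      exact ⟨fun h j hj _ => h j hj, fun h j hj => h j hj (π j).2⟩
    have hstep : π i ∈ (greedyRun G.lineGraph lam π (t + 1)).alive ↔
        π i ∈ (greedyRun G.lineGraph lam π t).alive ∧
          (Touching π i ⟨t, htm⟩ → ¬ IsMatched π G ⟨t, htm⟩) := by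
      rw [greedyRun_succ π ⟨t, htm⟩]
      rw [mem_next_alive, hmatch, touching_iff_eq_or_adj, SimpleGraph.adj_comm]
      tauto
    rw [hstep, ih i htm.le]
    constructor
    · rintro ⟨h1, h2⟩ k hk
      rcases Nat.lt_succ_iff_lt_or_eq.1 hk with h | h
      · exact h1 k h
      · obtain rfl : k = ⟨t, htm⟩ := Fin.ext h
        exact h2
    · exact fun h => ⟨fun k hk => h k (by omega), h ⟨t, htm⟩ (by simp)⟩

/-- A child `j` of `i` is processed while `i` is alive, because no matched edge before `j` touches
`i`; so it passes on `lam` times its weight at that moment. -/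
theorem sum_children_weight_le (hlam : 0 ≤ lam) (π : EdgeOrder G) (i : Fin G.edgeSet.ncard)
    (t : ℕ) (ht : t ≤ G.edgeSet.ncard) :
    1 + lam * ∑ j ∈ (children π G i).filter (fun j => j.val < t),
        (greedyRun G.lineGraph lam π j).weight (π j) ≤
      (greedyRun G.lineGraph lam π t).weight (π i) := by
  induction t with
  | zero => simp [greedyRun]
  | succ t ih =>
    have htm : t < G.edgeSet.ncard := by omega
    have ih := ih htm.le
    by_cases hch : (⟨t, htm⟩ : Fin G.edgeSet.ncard) ∈ children π G i
    · have hins : (children π G i).filter (fun j => j.val < t + 1) =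
          insert ⟨t, htm⟩ ((children π G i).filter fun j => j.val < t) := by
        ext j
        simp only [Finset.mem_filter, Finset.mem_insert, Fin.ext_iff]
        constructor
        · rintro ⟨h1, h2⟩
          rcases Nat.lt_succ_iff_lt_or_eq.1 h2 with h | h
          · exact Or.inr ⟨h1, h⟩
          · exact Or.inl h
        · rintro (h | ⟨h1, h2⟩)
          · obtain rfl : j = ⟨t, htm⟩ := Fin.ext h
            exact ⟨hch, by simp⟩
          · exact ⟨h1, by omega⟩
      obtain ⟨h1, _, h3, h4⟩ := mem_children.1 hch
      have halive : π i ∈ (greedyRun G.lineGraph lam π t).alive :=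
        (mem_alive_iff π i t htm.le).2 fun k hk hik => h4 k hk (π k).2 hik
      have hadj : G.lineGraph.Adj (π ⟨t, htm⟩) (π i) := by
        rcases touching_iff_eq_or_adj.1 h3 with h | h
        · exact absurd (π.injective h) h1.ne'
        · exact h.symm
      rw [hins, Finset.sum_insert (by simp), greedyRun_succ π ⟨t, htm⟩]
      simp only [GreedyState.next]
      rw [if_pos ⟨halive, hadj⟩, mul_add]
      linarith
    · have heq : (children π G i).filter (fun j => j.val < t + 1) =
          (children π G i).filter fun j => j.val < t := by
        refine Finset.filter_congr fun j hj => ?_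
        have : j.val ≠ t := fun h => hch (by rwa [show j = ⟨t, htm⟩ from Fin.ext h] at hj)
        omega
      rw [heq]
      exact ih.trans (greedyRun_weight_mono hlam π (π i) (Nat.le_succ t))

theorem one_add_sum_children_weight_le (hlam : 0 ≤ lam) (π : EdgeOrder G)
    (i : Fin G.edgeSet.ncard) :
    1 + lam * ∑ j ∈ children π G i, (greedyRun G.lineGraph lam π j).weight (π j) ≤
      (greedyRun G.lineGraph lam π i).weight (π i) := by
  have := sum_children_weight_le hlam π i i i.2.le
  have hfil : (children π G i).filter (fun j => j.val < i.val) = children π G i :=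
    Finset.filter_true_of_mem fun j hj => (mem_children.1 hj).1
  rwa [hfil] at this

/-- With `lam = 1` the weight recursion would be that of the tree size; a larger `lam` only adds to
the weights. -/
theorem edgeQuery_le_weight (hlam : 1 ≤ lam) (π : EdgeOrder G) (i : Fin G.edgeSet.ncard) :
    ((edgeQuery π G i).2 : ℝ) ≤ (greedyRun G.lineGraph lam π i).weight (π i) := by
  induction i using WellFoundedLT.induction with
  | ind i ih =>
    have hlam0 : 0 ≤ lam := by linarith
    refine le_trans ?_ (one_add_sum_children_weight_le hlam0 π i)
    rw [edgeQuery_snd]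
    push_cast
    have h1 : ∑ j ∈ children π G i, ((edgeQuery π G j).2 : ℝ) ≤
        ∑ j ∈ children π G i, (greedyRun G.lineGraph lam π j).weight (π j) :=
      Finset.sum_le_sum fun j hj => ih j (mem_children.1 hj).1
    have h2 : 0 ≤ ∑ j ∈ children π G i, ((edgeQuery π G j).2 : ℝ) :=
      Finset.sum_nonneg fun j _ => Nat.cast_nonneg _
    nlinarith

/-- If the final weights are bounded by `x`, then few steps suffice. -/
theorem iterate_step_eq_bot_of_weight_le (hlam : 1 < lam) {π : EdgeOrder G} {B x : ℝ}
    (hB : 0 < B)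
    (hw : ∀ e, (greedyRun G.lineGraph lam π G.edgeSet.ncard).weight e ≤ x) {k : ℕ}
    (hk : (1 + Real.log x / Real.log lam) ^ k * x < (B / 2) ^ k) :
    (step π B)^[k] G = ⊥ := by
  have hlam0 : 0 ≤ lam := by linarith
  have hlog : 0 < Real.log lam := Real.log_pos hlam
  set W : Fin G.edgeSet.ncard → ℝ := fun i => (greedyRun G.lineGraph lam π i).weight (π i) with hW
  have hW1 : ∀ i, 1 ≤ W i := fun i => one_le_greedyRun_weight hlam0 π i _
  have hWx : ∀ i, W i ≤ x := fun i => (greedyRun_weight_mono hlam0 π (π i) i.2.le).trans (hw _)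
  -- The logarithm of the weight to base `lam` serves as depth: a parent weighs at least `lam` times
  -- any child.
  refine iterate_step_eq_bot (δ := fun i => 1 + Real.log (W i) / Real.log lam) hB
    (fun i => ?_) (fun i => ?_) (fun i j hj => ?_)
    (fun i => (edgeQuery_le_weight hlam.le π i).trans (hWx i)) hk
  · have := div_nonneg (Real.log_nonneg (hW1 i)) hlog.le
    linarith
  · have h0 : 0 < W i := by linarith [hW1 i]
    have := Real.log_le_log h0 (hWx i)
    gcongr
  · have h1 := one_add_sum_children_weight_le hlam0 π i
    have h2 := Finset.single_le_sum (f := W) (fun j _ => zero_le_one.trans (hW1 j)) hj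
    have h0 : 0 < W j := by linarith [hW1 j]
    have h3 : lam * W j ≤ W i := by
      have := mul_le_mul_of_nonneg_left h2 hlam0
      have h4 : W i = (greedyRun G.lineGraph lam π i).weight (π i) := rfl
      linarith
    have h5 := Real.log_le_log (by positivity) h3
    rw [Real.log_mul (by linarith) h0.ne'] at h5
    have h6 : Real.log (W j) / Real.log lam + 1 ≤ Real.log (W i) / Real.log lam := by
      rw [div_add_one hlog.ne']
      gcongr
      linarith
    linarith

end Link

/-! ### Choice of parameters and conclusion. -/

theorem card_edgeSet_le_sq {V : Type*} [Fintype V] (G : SimpleGraph V) :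
    G.edgeSet.ncard ≤ Fintype.card V ^ 2 := by
  classical
  rw [← SimpleGraph.coe_edgeFinset, Set.ncard_coe_finset]
  refine G.card_edgeFinset_le_card_choose_two.trans ?_
  exact Nat.choose_le_pow _ _

theorem one_sub_le_orderProb {V : Type*} [Fintype V] {G : SimpleGraph V} {P : EdgeOrder G → Prop}
    {p : ℝ}
    (s : Finset (EdgeOrder G)) (hs : (s.card : ℝ) ≤ p * Nat.card (EdgeOrder G))
    (hP : ∀ π, π ∉ s → P π) (hpos : 0 < Nat.card (EdgeOrder G)) :
    1 - p ≤ orderProb G P := by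
  classical
  have hfin : Finite (EdgeOrder G) := Nat.finite_of_card_ne_zero hpos.ne'
  have := Fintype.ofFinite (EdgeOrder G)
  have hN : (0 : ℝ) < Nat.card (EdgeOrder G) := by exact_mod_cast hpos
  rw [orderProb, le_div_iff₀ hN, Nat.card_eq_fintype_card (α := {π // P π}), Fintype.card_subtype]
  have h1 : sᶜ ⊆ Finset.univ.filter P := fun π hπ => by
    simpa using hP π (Finset.mem_compl.1 hπ)
  have h2 := Finset.card_le_card h1
  have h3 := Finset.card_add_card_compl s
  rw [← Nat.card_eq_fintype_card] at h3
  have h4 : (s.card : ℝ) + sᶜ.card = Nat.card (EdgeOrder G) := by exact_mod_cast h3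
  have h5 : ((sᶜ).card : ℝ) ≤ (Finset.univ.filter P).card := by exact_mod_cast h2
  linarith

/-- The final weights are polynomially bounded with high probability. -/
theorem card_orders_exists_weight_gt_le_rpow {V : Type*} [Fintype V] (G : SimpleGraph V)
    [Fintype G.edgeSet] {c lam : ℝ} (hc : 0 < c)
    (hn : 2 ≤ Fintype.card V)
    (hlam : lam = 1 + 1 / (2 * (2 * (c + 5) * Real.log (Fintype.card V)) *
      (1 + Real.log G.edgeSet.ncard))) (s : Finset (EdgeOrder G))
    (hs : ∀ π ∈ s, ∃ e, (Fintype.card V : ℝ) ^ (c + 9) <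
      (greedyRun G.lineGraph lam π G.edgeSet.ncard).weight e) :
    (s.card : ℝ) ≤ (Fintype.card V : ℝ) ^ (-c) * Nat.card (EdgeOrder G) := by
  classical
  have hn2 : (2 : ℝ) ≤ (Fintype.card V : ℝ) := by exact_mod_cast hn
  have hm : (G.edgeSet.ncard : ℝ) ≤ (Fintype.card V : ℝ) ^ 2 := by
    exact_mod_cast card_edgeSet_le_sq G
  set n : ℝ := (Fintype.card V : ℝ)
  have hn0 : 0 < n := by linarith
  rcases Nat.eq_zero_or_pos G.edgeSet.ncard with h0 | hpos
  · have : s = ∅ := by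
      refine Finset.eq_empty_of_forall_notMem fun π hπ => ?_
      obtain ⟨e, _⟩ := hs π hπ
      have := (π.symm e).2
      omega
    rw [this]
    simp only [Finset.card_empty, CharP.cast_eq_zero]
    positivity
  · have hcard : Fintype.card G.edgeSet = G.edgeSet.ncard := by
      rw [← Nat.card_eq_fintype_card]; rfl
    have hlog2 : (1 : ℝ) / 2 ≤ Real.log n := by
      have := Real.log_le_log (by norm_num) hn2
      linarith [Real.log_two_gt_d9]
    have hK : 1 ≤ 2 * (c + 5) * Real.log n := by nlinarith
    have hx : 0 < n ^ (c + 9) := by positivity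
    have key := card_orders_exists_weight_gt_le (L := G.lineGraph) hcard hpos hK hlam hx s hs
    refine key.trans (mul_le_mul_of_nonneg_right ?_ (Nat.cast_nonneg _))
    have hm2 : (G.edgeSet.ncard : ℝ) ^ 2 ≤ n ^ 4 := by
      calc _ ≤ (n ^ 2) ^ 2 := by gcongr
        _ = _ := by ring
    -- `K = 2 * (c + 5) * log n` and the threshold `n ^ (c + 9)` each beat `m ^ 2 ≤ n ^ 4`, leaving
    -- the factors `1 / n` and `9 / n ^ 5`, whose sum is below `1` for `n ≥ 2`.
    have he : Real.exp (-(2 * (c + 5) * Real.log n / 2)) = n ^ (-c) * (n ^ 5)⁻¹ := by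
      rw [← Real.rpow_natCast n 5, ← Real.rpow_neg hn0.le, ← Real.rpow_add hn0,
        Real.rpow_def_of_pos hn0]
      congr 1
      push_cast
      ring
    have he2 : n ^ (c + 9) = (n ^ (-c))⁻¹ * n ^ 9 := by
      rw [← Real.rpow_neg hn0.le, ← Real.rpow_natCast n 9, ← Real.rpow_add hn0]
      congr 1
      push_cast
      ring
    have hq : 0 < n ^ (-c) := by positivity
    rw [he, he2]
    calc _ ≤ n ^ 4 * (n ^ (-c) * (n ^ 5)⁻¹) + 9 * n ^ 4 / ((n ^ (-c))⁻¹ * n ^ 9) := by gcongr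
      _ = n ^ (-c) * (1 / n + 9 / n ^ 5) := by field_simp
      _ ≤ n ^ (-c) * (1 / 2 + 9 / 2 ^ 5) := by gcongr
      _ ≤ n ^ (-c) := by nlinarith

theorem eventually_log_pow_le_rpow (A : ℝ) {s : ℝ} (hs : 0 < s) :
    ∃ n₀ : ℕ, 3 ≤ n₀ ∧ ∀ n : ℕ, n₀ ≤ n → A * Real.log n ^ 3 ≤ (n : ℝ) ^ s := by
  have h1 := (isLittleO_log_rpow_rpow_atTop 3 hs).bound (c := 1 / (|A| + 1)) (by positivity)
  have h2 := tendsto_natCast_atTop_atTop.eventually h1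
  obtain ⟨N, hN⟩ := Filter.eventually_atTop.1 h2
  refine ⟨max N 3, le_max_right _ _, fun n hn => ?_⟩
  have h3 := hN n ((le_max_left _ _).trans hn)
  have hn1 : (1 : ℝ) ≤ n := by exact_mod_cast (by have := (le_max_right N 3).trans hn; omega)
  have hl : 0 ≤ Real.log n := Real.log_nonneg hn1
  rw [Real.norm_of_nonneg (by positivity), Real.norm_of_nonneg (by positivity),
    show (3 : ℝ) = ((3 : ℕ) : ℝ) by norm_num, Real.rpow_natCast, div_mul_eq_mul_div,
    one_mul, le_div_iff₀ (by positivity)] at h3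
  have h4 : 0 ≤ Real.log n ^ 3 := by positivity
  nlinarith [le_abs_self A]

/-- The depth bound is subpolynomial and the number of steps makes up for the polynomial bound on
the sizes of the query trees. -/
theorem depth_pow_mul_lt {c ε : ℝ} (hc : 0 < c) (hε0 : 0 < ε) (hε1 : ε < 1) :
    ∃ n₀ : ℕ, 3 ≤ n₀ ∧ ∀ n m : ℕ, n₀ ≤ n → m ≤ n ^ 2 →
      (1 + Real.log ((n : ℝ) ^ (c + 9)) /
        Real.log (1 + 1 / (2 * (2 * (c + 5) * Real.log n) * (1 + Real.log m)))) ^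
          ⌊(2 * c + 19) / ε⌋₊ * (n : ℝ) ^ (c + 9) <
        ((n : ℝ) ^ ε / 2) ^ ⌊(2 * c + 19) / ε⌋₊ := by
  obtain ⟨n₀, h3, hn₀⟩ := eventually_log_pow_le_rpow (2 * (1 + 24 * (c + 9) * (c + 5)))
    (half_pos hε0)
  refine ⟨n₀, h3, fun n m hn hm => ?_⟩
  have hA := hn₀ n hn
  have hn3 : (3 : ℝ) ≤ n := by exact_mod_cast h3.trans hn
  have hn0 : (0 : ℝ) < n := by linarith
  set l := Real.log n with hl
  have hl1 : 1 ≤ l := by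
    rw [hl, Real.le_log_iff_exp_le hn0]
    linarith [Real.exp_one_lt_d9]
  have hlm0 : 0 ≤ Real.log m := Real.log_natCast_nonneg m
  have hlm : Real.log m ≤ 2 * l := by
    rcases Nat.eq_zero_or_pos m with h | h
    · rw [h]; simp; linarith
    · have h1 : Real.log m ≤ Real.log ((n : ℝ) ^ 2) :=
        Real.log_le_log (by exact_mod_cast h) (by exact_mod_cast hm)
      rw [Real.log_pow] at h1
      exact_mod_cast h1
  set q := 2 * (2 * (c + 5) * l) * (1 + Real.log m) with hq
  have hq1 : 1 ≤ q := by
    have h1 : 1 ≤ 2 * (2 * (c + 5) * l) := by nlinarith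
    nlinarith
  have hq2 : q ≤ 12 * (c + 5) * l ^ 2 := by
    have : 1 + Real.log m ≤ 3 * l := by linarith
    calc q ≤ 2 * (2 * (c + 5) * l) * (3 * l) := by rw [hq]; gcongr
      _ = _ := by ring
  have hloglam : 1 / (2 * q) ≤ Real.log (1 + 1 / q) := by
    have hq0 : 0 < q := by linarith
    refine le_trans ?_ (Real.one_sub_inv_le_log_of_pos (by positivity))
    have : 1 - (1 + 1 / q)⁻¹ = 1 / (q + 1) := by
      field_simp
      ring
    rw [this]
    gcongr
    linarith
  have hlogx : Real.log ((n : ℝ) ^ (c + 9)) = (c + 9) * l := Real.log_rpow hn0 _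
  set D := 1 + Real.log ((n : ℝ) ^ (c + 9)) / Real.log (1 + 1 / q) with hD
  have hD1 : D ≤ (1 + 24 * (c + 9) * (c + 5)) * l ^ 3 := by
    have h1 : Real.log ((n : ℝ) ^ (c + 9)) / Real.log (1 + 1 / q) ≤
        (c + 9) * l / (1 / (2 * q)) := by
      rw [hlogx]
      have : 0 < 1 / (2 * q) := by positivity
      gcongr
    have h2 : (c + 9) * l / (1 / (2 * q)) = (c + 9) * l * (2 * q) := by
      rw [div_div_eq_mul_div, div_one]
    have h4 : (c + 9) * l * (2 * q) ≤ (c + 9) * l * (2 * (12 * (c + 5) * l ^ 2)) := by gcongr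
    have h5 : 1 ≤ l ^ 3 := one_le_pow₀ hl1
    calc D ≤ 1 + (c + 9) * l * (2 * (12 * (c + 5) * l ^ 2)) := by rw [hD]; linarith
      _ ≤ l ^ 3 + (c + 9) * l * (2 * (12 * (c + 5) * l ^ 2)) := by gcongr
      _ = _ := by ring
  have hD0 : 0 < D := by
    have h1 : 0 < Real.log (1 + 1 / q) := lt_of_lt_of_le (by positivity) hloglam
    have h2 : 0 ≤ (c + 9) * l := by positivity
    have := div_nonneg h2 h1.le
    rw [hD, hlogx]
    linarith
  -- Half of the exponent `ε` absorbs the depth; the other half beats the polynomial size.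
  have hDn : D ≤ (n : ℝ) ^ (ε / 2) / 2 := by linarith
  set k := ⌊(2 * c + 19) / ε⌋₊ with hk
  have hk1 : (2 * c + 19) / ε < k + 1 := Nat.lt_floor_add_one _
  rw [div_lt_iff₀ hε0] at hk1
  have hpow : (n : ℝ) ^ (c + 9) < ((n : ℝ) ^ (ε / 2)) ^ k := by
    rw [← Real.rpow_natCast, ← Real.rpow_mul hn0.le]
    refine Real.rpow_lt_rpow_of_exponent_lt (by linarith) ?_
    nlinarith
  have hhalf : (n : ℝ) ^ ε = (n : ℝ) ^ (ε / 2) * (n : ℝ) ^ (ε / 2) := by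
    rw [← Real.rpow_add hn0]; congr 1; ring
  calc D ^ k * (n : ℝ) ^ (c + 9) < D ^ k * ((n : ℝ) ^ (ε / 2)) ^ k := by gcongr
    _ ≤ ((n : ℝ) ^ (ε / 2) / 2) ^ k * ((n : ℝ) ^ (ε / 2)) ^ k := by gcongr
    _ = _ := by rw [← mul_pow, hhalf]; congr 1; ring

end MatchingQuery

theorem mainTheorem7 (c : ℝ) (hc : 0 < c) :
    ∃ C : ℝ, 0 < C ∧ ∀ ε : ℝ, 0 < ε → ε < 1 →
      ∃ n₀ : ℕ, ∀ (V : Type*) [Fintype V] (G : SimpleGraph V), n₀ ≤ Fintype.card V →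
        1 - (Fintype.card V : ℝ) ^ (-c) ≤
          MatchingQuery.orderProb G (fun π =>
            (MatchingQuery.step π ((Fintype.card V : ℝ) ^ ε))^[⌊C / ε⌋₊] G = ⊥) := by
  -- The number `k` of rounds must satisfy `k * ε / 2 > c + 9`; the `1` in `2 * (c + 9) + 1` makes
  -- up for the floor, as `ε < 1`.
  refine ⟨2 * c + 19, by positivity, fun ε hε0 hε1 => ?_⟩
  obtain ⟨n₀, h3, hn₀⟩ := MatchingQuery.depth_pow_mul_lt hc hε0 hε1
  refine ⟨n₀, fun V _ G hn => ?_⟩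
  classical
  have hcard : Fintype.card V ≥ 2 := by omega
  have hlogn : 0 < Real.log (Fintype.card V) := Real.log_pos (by exact_mod_cast hcard)
  set lam : ℝ := 1 + 1 / (2 * (2 * (c + 5) * Real.log (Fintype.card V)) *
    (1 + Real.log G.edgeSet.ncard)) with hlam
  have hlam1 : 1 < lam := by
    -- Includes the edgeless graph, through `Real.log 0 = 0`.
    have := Real.log_natCast_nonneg G.edgeSet.ncard
    rw [hlam, lt_add_iff_pos_right]
    positivity
  refine MatchingQuery.one_sub_le_orderProb
    (Finset.univ.filter fun π : MatchingQuery.EdgeOrder G =>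
      ∃ e, (Fintype.card V : ℝ) ^ (c + 9) <
        (MatchingQuery.greedyRun G.lineGraph lam π G.edgeSet.ncard).weight e)
    (MatchingQuery.card_orders_exists_weight_gt_le_rpow G hc hcard hlam _
      fun π hπ => (Finset.mem_filter.1 hπ).2) (fun π hπ => ?_) ?_
  · have hw : ∀ e, (MatchingQuery.greedyRun G.lineGraph lam π G.edgeSet.ncard).weight e ≤
        (Fintype.card V : ℝ) ^ (c + 9) := by
      simpa using hπ
    refine MatchingQuery.iterate_step_eq_bot_of_weight_le hlam1 ?_ hw
      (hn₀ _ _ hn (MatchingQuery.card_edgeSet_le_sq G))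
    have : (0 : ℝ) < Fintype.card V := by exact_mod_cast (by omega : 0 < Fintype.card V)
    positivity
  · have : Nonempty (MatchingQuery.EdgeOrder G) := ⟨(Finite.equivFin G.edgeSet).symm⟩
    exact Nat.card_pos
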